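/- Let $M$ be a lattice of rank $d$ with dual lattice $N$, and let $\Lambda\subset M$ be a finitely generated subsemigroup with $0 \in \Lambda$ which generates $M$ as a group and whose cone $\sigma^\vee=\mathbf R_{\ge 0}\Lambda\subset M_{\mathbf R}$ is strictly convex. Let $\sigma\subset N_{\mathbf R}$ be the dual cone, $\stackrel{\circ}{\sigma}$ its interior, and $e_1,\dots,e_n$ the minimal system of generators of $\Lambda$. The monomials $x_i=X^{e_i}$ embed the affine toric variety $Z^\Lambda=\mathrm{Spec}\,\mathbf C[\Lambda]$ in $\mathbf C^n$; let $0\in Z^\Lambda$ be the point with all $x_i=0$. For $1\le k\le d$ let $\mathcal J_k$ be the set of the sums $e_{i_1}+\cdots+e_{i_k}$ with $1\le i_1<\cdots<i_k\le n$ and $e_{i_1}\wedge\cdots\wedge e_{i_k}\ne 0$, let $\mathcal N(\mathcal J_k)$ be the convex hull of $\mathcal J_k+\sigma^\vee$, and for $\nu\in\sigma$ let $\mathrm{ord}_{\mathcal J_k}(\nu)=\inf\{\langle\nu,\omega\rangle \mid \omega\in\mathcal N(\mathcal J_k)\}$. Put $\phi_0=0$ and $\phi_{d+1}=+\infty$;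 if $d\ge 1$, put also $\phi_1=\mathrm{ord}_{\mathcal J_1}$ and $\phi_k=\mathrm{ord}_{\mathcal J_k}-\mathrm{ord}_{\mathcal J_{k-1}}$ for $2\le k\le d$. For $0\le k\le d$ let $A_k$ be the set of pairs $(\nu,s)$ with $\nu\in\stackrel{\circ}{\sigma}\cap N$, $s\in\mathbf Z_{\ge 0}$ and $\phi_k(\nu)\le s<\phi_{k+1}(\nu)$. Let $H_s(Z^\Lambda)_0$ be the scheme of $s$-jets of $Z^\Lambda$ with origin at $0$, with its reduced structure. For $\nu\in\stackrel{\circ}{\sigma}\cap N$ let $H^*_\nu$ be the set of arcs $h:\mathrm{Spec}\,\mathbf C[[t]]\to Z^\Lambda$ with origin at $0$ and generic point in the torus such that the order in $t$ of $X^u\circ h$ is $\langle\nu,u\rangle$ for all $u\in\Lambda$, and let $j_s(H^*_\nu)$ be the set of the $s$-jets $h \bmod t^{s+1}$ of the arcs $h\in H^*_\nu$, a set of $\mathbf C$-rational points of $H_s(Z^\Lambda)_0$. **Theorem.** Let $0\le k\le d$ and $(\nu,s)\in A_k$. Then $j_s(H^*_\nu)$ is (the set of $\mathbf C$-rational points of)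 a locally closed subset of $H_s(Z^\Lambda)_0$. With its reduced structure, it is isomorphic over $\mathbf C$ to a point $\mathrm{Spec}\,\mathbf C$ if $k=0$, and to $(\mathbf C^*)^k\times\mathbf A_{\mathbf C}^{ks-\mathrm{ord}_{\mathcal J_k}(\nu)}$ if $k>0$; in the latter case $ks-\mathrm{ord}_{\mathcal J_k}(\nu)$ is a non-negative integer. -/

import Mathlib

open scoped TensorProduct Pointwise
open CategoryTheory AlgebraicGeometry

noncomputable section

namespace ToricJets

/-! ### Lattices, cones and Newton polyhedra

`M` is a lattice, `N = Hom(M, ℤ)` is its dual, `M_ℝ = ℝ ⊗ M`, and `N_ℝ` is the dual space of `M_ℝ`.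
The semigroup `Λ ⊆ M` has the generators `e 0, …, e (n - 1)`. -/

section Cones

variable {M : Type*} [AddCommGroup M]

/-- The image in `M_ℝ` of a vector of the lattice `M`. -/
def toReal (m : M) : ℝ ⊗[ℤ] M := 1 ⊗ₜ[ℤ] m

/-- The cone `σ^∨ = ℝ_{≥ 0} Λ` of `M_ℝ`. -/
def sigmaDual (Λ : AddSubmonoid M) : PointedCone ℝ (ℝ ⊗[ℤ] M) :=
  PointedCone.hull ℝ (toReal '' (Λ : Set M))

/-- The cone `σ` of `N_ℝ`, dual to `σ^∨`. -/
def sigma (Λ : AddSubmonoid M) : Set (Module.Dual ℝ (ℝ ⊗[ℤ] M)) :=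
  {f | ∀ w ∈ sigmaDual Λ, 0 ≤ f w}

/-- The inclusion of the dual lattice `N` in `N_ℝ`. -/
def dualToReal (ν : Module.Dual ℤ M) : Module.Dual ℝ (ℝ ⊗[ℤ] M) :=
  LinearMap.liftBaseChange ℝ ((Algebra.linearMap ℤ ℝ).comp ν)

/-- The lattice vectors of the interior of `σ`, for the usual topology of the finite dimensional
real vector space `N_ℝ`. When `σ^∨` is strictly convex, `σ` has full dimension, and its relative
interior is its interior. -/
def interiorPoints (Λ : AddSubmonoid M) : Set (Module.Dual ℤ M) :=
  {ν | dualToReal ν ∈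
    @interior _ (moduleTopology ℝ (Module.Dual ℝ (ℝ ⊗[ℤ] M))) (sigma Λ)}

/-- The set of exponents `e_{i_1} + ⋯ + e_{i_k}`, with `i_1 < ⋯ < i_k` and
`e_{i_1} ∧ ⋯ ∧ e_{i_k} ≠ 0`, of the `k`-th logarithmic jacobian ideal. -/
def logJacobian {Λ : AddSubmonoid M} {n : ℕ} (e : Fin n → Λ) (k : ℕ) : Set M :=
  {w | ∃ i : Fin k ↪o Fin n,
    ExteriorAlgebra.ιMulti ℝ k (fun r => toReal (e (i r) : M)) ≠ 0 ∧ w = ∑ r, (e (i r) : M)}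

/-- The Newton polyhedron of the monomial ideal of `ℂ[Λ]` with the set of exponents `I`. -/
def newtonPolyhedron (Λ : AddSubmonoid M) (I : Set M) : Set (ℝ ⊗[ℤ] M) :=
  convexHull ℝ (toReal '' I + (sigmaDual Λ : Set (ℝ ⊗[ℤ] M)))

/-- The value at `ν` of the support function of the Newton polyhedron of `I`. -/
def ord (Λ : AddSubmonoid M) (I : Set M) (ν : Module.Dual ℤ M) : ℝ :=
  sInf ((dualToReal ν) '' newtonPolyhedron Λ I)

/-- The functions `φ_0 = 0`, `φ_1 = ord_{J_1}`, `φ_k = ord_{J_k} - ord_{J_{k-1}}` for `2 ≤ k ≤ d`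
and `φ_{d+1} = +∞`, where `d` is the rank of `M`. -/
def phi {Λ : AddSubmonoid M} {n : ℕ} (e : Fin n → Λ) (k : ℕ) (ν : Module.Dual ℤ M) : EReal :=
  if k = 0 then 0
  else if Module.finrank ℤ M < k then ⊤
  else if k = 1 then (ord Λ (logJacobian e 1) ν : ℝ)
  else (ord Λ (logJacobian e k) ν - ord Λ (logJacobian e (k - 1)) ν : ℝ)

/-- The set `A_k` of the pairs `(ν, s)` with `ν` in the interior of `σ` and
`φ_k(ν) ≤ s < φ_{k+1}(ν)`. -/
def setA {Λ : AddSubmonoid M} {n : ℕ} (e : Fin n → Λ) (k : ℕ) : Set (Module.Dual ℤ M × ℕ) :=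
  {p | p.1 ∈ interiorPoints Λ ∧
    phi e k p.1 ≤ ((p.2 : ℝ) : EReal) ∧ ((p.2 : ℝ) : EReal) < phi e (k + 1) p.1}

end Cones

/-! ### The toric variety and its jet schemes -/

section Jets

variable {M : Type*} [AddCommGroup M] {Λ : AddSubmonoid M} {n : ℕ}

/-- The monomial `X^u` of `ℂ[Λ]`. -/
def monom (u : Λ) : AddMonoidAlgebra ℂ Λ := AddMonoidAlgebra.single u 1

/-- The map `ℂ[x_1, …, x_n] → ℂ[Λ]`, `x_i ↦ X^{e_i}`, which embeds `Z^Λ = Spec ℂ[Λ]` in the affine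
space. -/
def toricMap (e : Fin n → Λ) : MvPolynomial (Fin n) ℂ →ₐ[ℂ] AddMonoidAlgebra ℂ Λ :=
  MvPolynomial.aeval fun i => monom (e i)

/-- The coordinate ring `ℂ[a_i^{(j)}]`, `0 ≤ j ≤ s`, of the space of `s`-jets of the affine space;
the variable `a_i^{(j)}` has the index `(i, j)`. -/
abbrev AffineJetRing (n s : ℕ) : Type := MvPolynomial (Fin n × Fin (s + 1)) ℂ

/-- The universal `s`-jet `x_i(t) = a_i^{(0)} + a_i^{(1)} t + ⋯ + a_i^{(s)} t^s`. -/
def universalJet (n s : ℕ) (i : Fin n) : Polynomial (AffineJetRing n s) :=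
  ∑ j : Fin (s + 1), Polynomial.C (MvPolynomial.X (i, j)) * Polynomial.X ^ (j : ℕ)

/-- The coefficient `α_F^{(l)}` of `t^l` in `F(x_1(t), …, x_n(t))`. -/
def alpha (s : ℕ) (F : MvPolynomial (Fin n) ℂ) (l : ℕ) : AffineJetRing n s :=
  (MvPolynomial.aeval (universalJet n s) F).coeff l

/-- The equations of the `s`-jets of `Z^Λ` with origin at `0`: the `α_F^{(l)}` with `0 ≤ l ≤ s` and
`F` in the ideal of `Z^Λ`, and the coordinates `a_i^{(0)}` of the origin of the jet. -/
def jetEquations (e : Fin n → Λ) (s : ℕ) : Set (AffineJetRing n s) :=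
  {f | (∃ F ∈ RingHom.ker (toricMap e), ∃ l ≤ s, f = alpha s F l) ∨
    ∃ i, f = MvPolynomial.X (i, 0)}

/-- The ideal of the jet scheme `H_s(Z^Λ)_0` with its reduced structure. -/
def jetIdeal (e : Fin n → Λ) (s : ℕ) : Ideal (AffineJetRing n s) :=
  (Ideal.span (jetEquations e s)).radical

/-- The coordinate ring of the jet scheme `H_s(Z^Λ)_0` with its reduced structure. -/
abbrev JetRing (e : Fin n → Λ) (s : ℕ) : Type := AffineJetRing n s ⧸ jetIdeal e s

/-- The arcs `Spec ℂ⟦t⟧ → Z^Λ`. -/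
abbrev Arc (Λ : AddSubmonoid M) : Type _ := AddMonoidAlgebra ℂ Λ →ₐ[ℂ] PowerSeries ℂ

/-- The arcs of `Z^Λ` with origin at `0`, that is, with `x_i(0) = 0` for all `i`. -/
def arcsAtOrigin (e : Fin n → Λ) : Set (Arc Λ) :=
  {h | ∀ i, PowerSeries.constantCoeff (h (monom (e i))) = 0}

/-- The set `H^*` of the arcs with origin at `0` and with generic point in the torus, which is the
open subset of `Z^Λ` where no monomial `X^u` vanishes. -/
def torusArcs (e : Fin n → Λ) : Set (Arc Λ) :=
  {h | h ∈ arcsAtOrigin e ∧ ∀ u : Λ, h (monom u) ≠ 0}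

/-- The set `H^*_ν` of the arcs `h` in `H^*` of order `ν_h = ν`, where `X^u ∘ h` has the order
`⟨ν_h, u⟩` in `t` for all `u` in `Λ`. -/
def orbit (e : Fin n → Λ) (ν : Module.Dual ℤ M) : Set (Arc Λ) :=
  {h | h ∈ torusArcs e ∧ ∀ u : Λ, ((PowerSeries.order (h (monom u))).toNat : ℤ) = ν (u : M)}

/-- The `s`-jet of an arc, as a point of the jet space of the affine space: the value of `a_i^{(j)}`
is the coefficient of `t^j` in `X^{e_i} ∘ h`. -/
def jetEval (e : Fin n → Λ) (s : ℕ) (h : Arc Λ) : AffineJetRing n s →ₐ[ℂ] ℂ :=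
  MvPolynomial.aeval fun p => PowerSeries.coeff (p.2 : ℕ) (h (monom (e p.1)))

theorem coeff_map_universalJet (e : Fin n → Λ) (s : ℕ) (h : Arc Λ) (i : Fin n) (l : ℕ)
    (hl : l ≤ s) :
    ((universalJet n s i).map (jetEval e s h).toRingHom).coeff l =
      PowerSeries.coeff l (h (monom (e i))) := by
  rw [Polynomial.coeff_map, universalJet, Polynomial.finsetSum_coeff,
    Finset.sum_eq_single (⟨l, Nat.lt_succ_of_le hl⟩ : Fin (s + 1))]
  · rw [Polynomial.coeff_C_mul_X_pow, if_pos rfl]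
    exact MvPolynomial.aeval_X _ _
  · intro j _ hj
    rw [Polynomial.coeff_C_mul_X_pow, if_neg]
    intro hlj
    exact hj (Fin.ext hlj.symm)
  · intro hj
    exact absurd (Finset.mem_univ _) hj

theorem jetEval_alpha (e : Fin n → Λ) (s : ℕ) (h : Arc Λ) (F : MvPolynomial (Fin n) ℂ) (l : ℕ)
    (hl : l ≤ s) :
    jetEval e s h (alpha s F l) = PowerSeries.coeff l (h (toricMap e F)) := by
  let I : Ideal (PowerSeries ℂ) := Ideal.span {PowerSeries.X ^ (s + 1)}
  let f : MvPolynomial (Fin n) ℂ →ₐ[ℂ] PowerSeries ℂ ⧸ I :=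
    ((Ideal.Quotient.mkₐ ℂ I).comp h).comp (toricMap e)
  let g : MvPolynomial (Fin n) ℂ →ₐ[ℂ] PowerSeries ℂ ⧸ I :=
    (((Ideal.Quotient.mkₐ ℂ I).comp (Polynomial.coeToPowerSeries.algHom ℂ)).comp
      (Polynomial.mapAlgHom (jetEval e s h))).comp (MvPolynomial.aeval (universalJet n s))
  have hX : ∀ a b : PowerSeries ℂ, Ideal.Quotient.mk I a = Ideal.Quotient.mk I b ↔
      ∀ r < s + 1, PowerSeries.coeff r a = PowerSeries.coeff r b := by
    intro a b
    rw [Ideal.Quotient.eq, Ideal.mem_span_singleton, PowerSeries.X_pow_dvd_iff]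
    simp only [map_sub, sub_eq_zero]
  have hfg : g = f := by
    refine MvPolynomial.algHom_ext fun i => ?_
    refine Eq.trans ?_ (((hX ((universalJet n s i).map (jetEval e s h).toRingHom : Polynomial ℂ)
      (h (monom (e i)))).2 fun r hr => ?_).trans ?_)
    · simp [g, Polynomial.coeToPowerSeries.algHom_apply]
    · rw [Polynomial.coeff_coe]
      exact coeff_map_universalJet e s h i r (Nat.le_of_lt_succ hr)
    · simp [f, toricMap]
  have key := (hX _ _).1 (DFunLike.congr_fun hfg F) l (Nat.lt_succ_of_le hl)
  refine Eq.trans ?_ key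
  change _ = PowerSeries.coeff l (Polynomial.coeToPowerSeries.algHom ℂ
    (Polynomial.mapAlgHom (jetEval e s h) (MvPolynomial.aeval (universalJet n s) F)))
  rw [Polynomial.coeToPowerSeries.algHom_apply, Algebra.algebraMap_self, PowerSeries.map_id]
  exact (Polynomial.coeff_map _ _).symm.trans (Polynomial.coeff_coe _ _).symm

theorem jetEval_eq_zero (e : Fin n → Λ) (s : ℕ) {h : Arc Λ} (h0 : h ∈ arcsAtOrigin e)
    (f : AffineJetRing n s) (hf : f ∈ jetIdeal e s) : jetEval e s h f = 0 := by
  have hle : Ideal.span (jetEquations e s) ≤ RingHom.ker (jetEval e s h) := by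
    rw [Ideal.span_le]
    rintro f (⟨F, hF, l, hl, rfl⟩ | ⟨i, rfl⟩)
    · have hF' : toricMap e F = 0 := hF
      exact (jetEval_alpha e s h F l hl).trans (by rw [hF', map_zero, map_zero])
    · refine (MvPolynomial.aeval_X _ _).trans ?_
      exact (PowerSeries.coeff_zero_eq_constantCoeff_apply _).trans (h0 i)
  exact (Ideal.IsPrime.radical_le_iff (RingHom.ker_isPrime _)).2 hle hf

/-- The `s`-jet `j_s(h)` of an arc `h` with origin at `0`, as a `ℂ`-rational point of
`H_s(Z^Λ)_0`. -/
def jet (e : Fin n → Λ) (s : ℕ) {h : Arc Λ} (h0 : h ∈ arcsAtOrigin e) : JetRing e s →ₐ[ℂ] ℂ :=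
  Ideal.Quotient.liftₐ (jetIdeal e s) (jetEval e s h) (jetEval_eq_zero e s h0)

/-- The set `j_s(H^*_ν)` of `ℂ`-rational points of `H_s(Z^Λ)_0`. -/
def jetsOfOrbit (e : Fin n → Λ) (s : ℕ) (ν : Module.Dual ℤ M) : Set (JetRing e s →ₐ[ℂ] ℂ) :=
  {x | ∃ (h : Arc Λ) (hh : h ∈ orbit e ν), x = jet e s hh.1.1}

end Jets

/-! ### Locally closed subsets of affine schemes over `ℂ` -/

section Schemes

variable (R : Type) [CommRing R] [Algebra ℂ R]

/-- The structure map of `Spec R` as a scheme over `ℂ`. -/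
def structureMap : Spec (CommRingCat.of R) ⟶ Spec (CommRingCat.of ℂ) :=
  Spec.map (CommRingCat.ofHom (algebraMap ℂ R))

variable {R} in
/-- The closed point of `Spec R` that underlies a `ℂ`-rational point. -/
def closedPoint (x : R →ₐ[ℂ] ℂ) : Spec (CommRingCat.of R) :=
  (⟨RingHom.ker x, RingHom.ker_isPrime x⟩ : PrimeSpectrum R)

variable {R} in
/-- The locally closed subset `Z` of `Spec R`, with its reduced scheme structure, is isomorphic to
`Spec B` over `ℂ`: the reduced scheme `Spec B` has an immersion in `Spec R` over `ℂ` with image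
`Z`. -/
def ReducedIso (Z : Set (Spec (CommRingCat.of R))) (B : Type) [CommRing B] [Algebra ℂ B] : Prop :=
  AlgebraicGeometry.IsReduced (Spec (CommRingCat.of B)) ∧
    ∃ f : Spec (CommRingCat.of B) ⟶ Spec (CommRingCat.of R),
      f ≫ structureMap R = structureMap B ∧ IsImmersion f ∧ Set.range f = Z

/-- The coordinate ring `ℂ[ℤ^k][y_1, …, y_m]` of `(ℂ^*)^k × 𝔸^m`. -/
abbrev TorusAffineRing (k m : ℕ) : Type := MvPolynomial (Fin m) (AddMonoidAlgebra ℂ (Fin k → ℤ))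

end Schemes

end ToricJets

end

open ToricJets

noncomputable section

/-! An arc of order ν with generic point in the torus sends `X^v` to `t^⟨ν,v⟩ u(v)`, where `u` is a
homomorphism from `M` to the units of `ℂ⟦t⟧`. Splitting off constant terms and taking logarithms
gives `u = c · exp W`, with `c : M → ℂ^*` a character and `W : M → ℂ⟦t⟧` additive, whose constant
terms play no role. Conversely every pair `(c, W)` gives such an arc.

The `s`-jet sees only the generators `e_i` of weight `w_i = ⟨ν, e_i⟩ ≤ s`. Let `T` be an independent
set of `k` generators of least total weight; this weight is `ord_{J_k}(ν)`. By exchange arguments,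
`φ_k(ν) ≤ s < φ_{k+1}(ν)` forces `T` to consist of generators of weight at most `s` and to span all
of them (`IsMinIndep.weight_le`, `IsMinIndep.toReal_mem_span`), and `e_j`, `j ∈ T`, occurs in `e_i`
only if `w_j ≤ w_i` (`IsMinIndep.weight_le_of_coeff_ne_zero`). The jet of `x_i` needs `W(e_i)` only
up to degree `s - w_i`, so the coefficients of degrees `1, …, s - w_j` of the `W(e_j)`, `j ∈ T`,
suffice. They are `∑ (s - w_j) = ks - ord_{J_k}(ν)` affine coordinates. The values of `c` form a
point of the `k`-dimensional torus of characters of the lattice generated by the `e_i` of weight at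
most `s`.

This defines a morphism from the torus times the affine space to the jet space whose rational points
are exactly the required jets (`JetFrame.exists_arc_of_point`, `JetFrame.exists_point_of_arc`); by
the Nullstellensatz it lands in the jet scheme. It is an immersion because, once the leading
coefficients are inverted, all coordinates can be recovered from the jet
(`JetFrame.fractionSubalgebra_jetHom`). -/

namespace ToricJets

/-! ### Formal exponentials and logarithms -/

section FormalExp

open PowerSeries

variable {B : Type*} [CommRing B] [Algebra ℂ B]

/-- The coefficients of the solution of `f' = w' f`, `f(0) = 1`. -/
def formalExpCoeff (w : PowerSeries B) : ℕ → B
  | 0 => 1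
  | n + 1 => ((n : ℂ) + 1)⁻¹ • ∑ i : Fin (n + 1),
      (coeff ((i : ℕ) + 1) w * ((i : ℕ) + 1)) * formalExpCoeff w (n - i)

/-- The exponential of `w - w(0)`. -/
def formalExp (w : PowerSeries B) : PowerSeries B := PowerSeries.mk (formalExpCoeff w)

theorem coeff_zero_formalExp (w : PowerSeries B) : coeff 0 (formalExp w) = 1 := by
  rw [formalExp, coeff_mk, formalExpCoeff]

theorem constantCoeff_formalExp (w : PowerSeries B) : constantCoeff (formalExp w) = 1 := by
  rw [← coeff_zero_eq_constantCoeff_apply, coeff_zero_formalExp]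

theorem coeff_succ_formalExp (w : PowerSeries B) (n : ℕ) :
    coeff (n + 1) (formalExp w) = ((n : ℂ) + 1)⁻¹ • ∑ i ∈ Finset.range (n + 1),
      (coeff (i + 1) w * ((i : B) + 1)) * coeff (n - i) (formalExp w) := by
  rw [formalExp, coeff_mk, formalExpCoeff, Finset.sum_range]
  simp only [coeff_mk]

/-- The equation determines `n + 1` times the coefficient of degree `n + 1` from the earlier ones,
and `n + 1` is invertible in a `ℂ`-algebra. -/
theorem formalExp_unique {w f : PowerSeries B} (h0 : constantCoeff f = 1)
    (h : derivative B f = derivative B w * f) : f = formalExp w := by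
  ext n
  induction n using Nat.strong_induction_on with
  | _ n ih =>
    cases n with
    | zero => rw [coeff_zero_formalExp, coeff_zero_eq_constantCoeff_apply, h0]
    | succ n =>
      have h1 := congrArg (coeff n) h
      rw [coeff_derivative, coeff_mul, Finset.Nat.sum_antidiagonal_eq_sum_range_succ_mk] at h1
      have h2 : coeff (n + 1) f = ((n : ℂ) + 1)⁻¹ • (coeff (n + 1) f * ((n : B) + 1)) := by
        have h3 : ((n : B) + 1) = algebraMap ℂ B ((n : ℂ) + 1) := by simp
        rw [h3, mul_comm, ← Algebra.smul_def, smul_smul, inv_mul_cancel₀, one_smul]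
        exact_mod_cast Nat.succ_ne_zero n
      rw [h2, h1, coeff_succ_formalExp]
      congr 1
      refine Finset.sum_congr rfl fun i hi => ?_
      rw [coeff_derivative, ih (n - i) (by omega)]

theorem derivative_formalExp (w : PowerSeries B) :
    derivative B (formalExp w) = derivative B w * formalExp w := by
  ext n
  rw [coeff_derivative, coeff_mul, Finset.Nat.sum_antidiagonal_eq_sum_range_succ_mk,
    coeff_succ_formalExp]
  have h3 : ((n : B) + 1) = algebraMap ℂ B ((n : ℂ) + 1) := by simp
  rw [h3, mul_comm, ← Algebra.smul_def, smul_smul, mul_inv_cancel₀, one_smul]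
  · refine Finset.sum_congr rfl fun i _ => ?_
    rw [coeff_derivative]
  · exact_mod_cast Nat.succ_ne_zero n

theorem formalExp_add (w w' : PowerSeries B) :
    formalExp (w + w') = formalExp w * formalExp w' := by
  refine (formalExp_unique ?_ ?_).symm
  · rw [map_mul, constantCoeff_formalExp, constantCoeff_formalExp, one_mul]
  · rw [Derivation.leibniz, derivative_formalExp, derivative_formalExp, map_add, smul_eq_mul,
      smul_eq_mul]
    ring

theorem formalExp_zero : formalExp (0 : PowerSeries B) = 1 :=
  (formalExp_unique (map_one _) (by rw [derivative_one, map_zero, zero_mul])).symm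

theorem map_formalExp {C : Type*} [CommRing C] [Algebra ℂ C] (f : B →ₐ[ℂ] C)
    (w : PowerSeries B) (r : ℕ) :
    f (coeff r (formalExp w)) = coeff r (formalExp (PowerSeries.map (f : B →+* C) w)) := by
  induction r using Nat.strong_induction_on with
  | _ n ih =>
    cases n with
    | zero => rw [coeff_zero_formalExp, coeff_zero_formalExp, map_one]
    | succ n =>
      rw [coeff_succ_formalExp, coeff_succ_formalExp, map_smul, map_sum]
      congr 1
      refine Finset.sum_congr rfl fun i hi => ?_
      rw [map_mul, map_mul, ih (n - i) (by omega)]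
      simp

/-- Truncation principle: an `r`-jet of an exponential involves only finitely many coordinates, and
never the constant term of the exponent. -/
theorem coeff_formalExp_congr {w w' : PowerSeries B} {r : ℕ}
    (h : ∀ i, 1 ≤ i → i ≤ r → coeff i w = coeff i w') :
    coeff r (formalExp w) = coeff r (formalExp w') := by
  induction r using Nat.strong_induction_on with
  | _ n ih =>
    cases n with
    | zero => rw [coeff_zero_formalExp, coeff_zero_formalExp]
    | succ n =>
      rw [coeff_succ_formalExp, coeff_succ_formalExp]
      congr 1
      refine Finset.sum_congr rfl fun i hi => ?_
      rw [Finset.mem_range] at hi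
      rw [h (i + 1) (by omega) (by omega),
        ih (n - i) (by omega) fun j hj hj' => h j hj (by omega)]

/-- Since `f = exp w` has constant term 1, `f' = w' f` can be solved recursively for `w'`: the
coefficients of a logarithm are polynomials in those of the exponential. -/
theorem coeff_mem_of_coeff_formalExp_mem (S : Subalgebra ℂ B) {w : PowerSeries B} {R : ℕ}
    (h : ∀ r ≤ R, coeff r (formalExp w) ∈ S) :
    ∀ r, r + 1 ≤ R → coeff (r + 1) w ∈ S := by
  intro n
  induction n using Nat.strong_induction_on with
  | _ n ih =>
    intro hn
    have h1 := congrArg (coeff n) (derivative_formalExp w)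
    rw [coeff_derivative, coeff_mul, Finset.Nat.sum_antidiagonal_eq_sum_range_succ_mk,
      Finset.sum_range_succ, Nat.sub_self, coeff_zero_formalExp, mul_one,
      ← sub_eq_iff_eq_add', coeff_derivative] at h1
    have h3 : ((n : B) + 1) = algebraMap ℂ B ((n : ℂ) + 1) := by simp
    have hnat : ∀ i : ℕ, (i : B) + 1 ∈ S := fun i => S.add_mem (natCast_mem S i) S.one_mem
    have h4 : coeff (n + 1) w * ((n : B) + 1) ∈ S := by
      rw [← h1]
      refine S.sub_mem (S.mul_mem (h _ hn) (hnat n)) (S.sum_mem fun i hi => ?_)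
      rw [Finset.mem_range] at hi
      rw [coeff_derivative]
      exact S.mul_mem (S.mul_mem (ih i hi (by omega)) (hnat i)) (h _ (by omega))
    have h5 := S.smul_mem h4 ((n : ℂ) + 1)⁻¹
    rwa [h3, mul_comm, ← Algebra.smul_def, smul_smul, inv_mul_cancel₀, one_smul] at h5
    exact_mod_cast Nat.succ_ne_zero n

/-- The primitive without constant term of the logarithmic derivative of `u`. -/
def logSeries (u : (PowerSeries ℂ)ˣ) : PowerSeries ℂ :=
  PowerSeries.mk fun n =>
    -- For `n = 0` the division by zero gives constant term 0.
    coeff (n - 1) (derivative ℂ (u : PowerSeries ℂ) * (↑u⁻¹ : PowerSeries ℂ)) / n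

theorem derivative_logSeries (u : (PowerSeries ℂ)ˣ) :
    derivative ℂ (logSeries u) = derivative ℂ (u : PowerSeries ℂ) * (↑u⁻¹ : PowerSeries ℂ) := by
  ext n
  rw [coeff_derivative, logSeries, coeff_mk]
  have : ((n : ℂ) + 1) ≠ 0 := by exact_mod_cast Nat.succ_ne_zero n
  push_cast
  field_simp

theorem logSeries_mul (u v : (PowerSeries ℂ)ˣ) :
    logSeries (u * v) = logSeries u + logSeries v := by
  have h : derivative ℂ ((u * v : (PowerSeries ℂ)ˣ) : PowerSeries ℂ) *
      (↑(u * v)⁻¹ : PowerSeries ℂ) =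
      derivative ℂ (u : PowerSeries ℂ) * (↑u⁻¹ : PowerSeries ℂ) +
      derivative ℂ (v : PowerSeries ℂ) * (↑v⁻¹ : PowerSeries ℂ) := by
    rw [mul_inv, Units.val_mul, Units.val_mul, Derivation.leibniz, smul_eq_mul, smul_eq_mul]
    linear_combination (derivative ℂ (v : PowerSeries ℂ) * (↑v⁻¹ : PowerSeries ℂ)) *
      u.mul_inv + (derivative ℂ (u : PowerSeries ℂ) * (↑u⁻¹ : PowerSeries ℂ)) * v.mul_inv
  ext n
  rw [map_add]
  simp only [logSeries, coeff_mk]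
  rw [h, map_add, add_div]

theorem C_mul_formalExp_logSeries (u : (PowerSeries ℂ)ˣ) :
    C (constantCoeff (u : PowerSeries ℂ)) * formalExp (logSeries u) = u := by
  have h0 : constantCoeff (u : PowerSeries ℂ) ≠ 0 :=
    (u.isUnit.map (constantCoeff (R := ℂ))).ne_zero
  have h : C (constantCoeff (u : PowerSeries ℂ))⁻¹ * (u : PowerSeries ℂ) =
      formalExp (logSeries u) := by
    refine formalExp_unique ?_ ?_
    · rw [map_mul, constantCoeff_C, inv_mul_cancel₀ h0]
    · rw [derivative_logSeries, Derivation.leibniz, derivative_C, smul_zero, add_zero, smul_eq_mul]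
      linear_combination (-C (constantCoeff (u : PowerSeries ℂ))⁻¹ *
        derivative ℂ (u : PowerSeries ℂ)) * u.inv_mul
  rw [← h, ← mul_assoc, ← map_mul, mul_inv_cancel₀ h0, map_one, one_mul]

end FormalExp

/-! ### Arcs with generic point in the torus -/

section Arcs

open PowerSeries

variable {M : Type*} [AddCommGroup M] {Λ : AddSubmonoid M} {n : ℕ}

theorem exists_eq_sub_of_closure_eq_top (hgen : AddSubgroup.closure (Λ : Set M) = ⊤) (m : M) :
    ∃ a b : Λ, m = a - b := by
  have hm : m ∈ AddSubgroup.closure (Λ : Set M) := hgen ▸ AddSubgroup.mem_top m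
  induction hm using AddSubgroup.closure_induction with
  | mem x hx => exact ⟨⟨x, hx⟩, 0, by simp⟩
  | zero => exact ⟨0, 0, by simp⟩
  | add x y _ _ hx hy =>
    obtain ⟨a, b, rfl⟩ := hx
    obtain ⟨a', b', rfl⟩ := hy
    exact ⟨a + a', b + b', by push_cast; abel⟩
  | neg x _ hx =>
    obtain ⟨a, b, rfl⟩ := hx
    exact ⟨b, a, by abel⟩

/-- The group `M` consists of differences of elements of `Λ`, so `F (a - b) = f a / f b` is forced,
and it is well defined because `f` takes values in a group. -/
theorem exists_monoidHom_extension (hgen : AddSubgroup.closure (Λ : Set M) = ⊤)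
    {G : Type*} [CommGroup G] (f : Multiplicative Λ →* G) :
    ∃ F : Multiplicative M →* G, ∀ v : Λ,
      F (Multiplicative.ofAdd (v : M)) = f (Multiplicative.ofAdd v) := by
  choose a b hab using exists_eq_sub_of_closure_eq_top hgen
  have key : ∀ x y x' y' : Λ, (x : M) - y = x' - y' →
      f (Multiplicative.ofAdd x) / f (Multiplicative.ofAdd y) =
      f (Multiplicative.ofAdd x') / f (Multiplicative.ofAdd y') := by
    intro x y x' y' h
    rw [div_eq_div_iff_mul_eq_mul, ← map_mul f, ← map_mul f, ← ofAdd_add, ← ofAdd_add]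
    congr 2
    ext
    push_cast
    exact sub_eq_sub_iff_add_eq_add.1 h
  refine ⟨MonoidHom.mk' (fun m => f (Multiplicative.ofAdd (a m.toAdd)) /
    f (Multiplicative.ofAdd (b m.toAdd))) fun m m' => ?_, fun v => ?_⟩
  · rw [div_mul_div_comm, ← map_mul f, ← map_mul f, ← ofAdd_add, ← ofAdd_add]
    apply key
    push_cast
    rw [← hab, toAdd_mul, hab m.toAdd, hab m'.toAdd, ← hab m.toAdd, ← hab m'.toAdd,
      add_sub_add_comm, ← hab, ← hab]
  · have := key (a v) (b v) v 0 (by rw [← hab]; simp)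
    simpa using this

/-- Removing the exact power of `t` leaves a unit that is multiplicative in `v`, because orders add
in `ℂ⟦t⟧`. -/
theorem exists_units_of_mem_orbit (hgen : AddSubgroup.closure (Λ : Set M) = ⊤)
    {e : Fin n → Λ} {ν : Module.Dual ℤ M} {h : Arc Λ} (hh : h ∈ orbit e ν) :
    ∃ u : Multiplicative M →* (PowerSeries ℂ)ˣ, ∀ v : Λ,
      h (monom v) = X ^ (ν v).toNat * (u (Multiplicative.ofAdd (v : M)) : PowerSeries ℂ) := by
  have h0 : ∀ v : Λ, h (monom v) ≠ 0 := hh.1.2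
  let f : Multiplicative Λ →* (PowerSeries ℂ)ˣ :=
    { toFun := fun v => Unit_of_divided_by_X_pow_order (h (monom v.toAdd))
      map_one' := by
        apply Units.ext
        have : monom (0 : Λ) = 1 := rfl
        rw [Unit_of_divided_by_X_pow_order_nonzero (h0 _), toAdd_one, this, map_one,
          divXPowOrder_one, Units.val_one]
      map_mul' := fun v v' => by
        apply Units.ext
        have : monom (v.toAdd + v'.toAdd) = monom v.toAdd * monom v'.toAdd := by
          rw [monom, monom, monom, AddMonoidAlgebra.single_mul_single, one_mul]
        rw [Units.val_mul, Unit_of_divided_by_X_pow_order_nonzero (h0 _),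
          Unit_of_divided_by_X_pow_order_nonzero (h0 _),
          Unit_of_divided_by_X_pow_order_nonzero (h0 _), toAdd_mul, this, map_mul,
          divXPowOrder_mul] }
  obtain ⟨F, hF⟩ := exists_monoidHom_extension hgen f
  refine ⟨F, fun v => ?_⟩
  rw [hF, ← hh.2 v, Int.toNat_natCast]
  change _ = _ * ((Unit_of_divided_by_X_pow_order (h (monom v)) : (PowerSeries ℂ)ˣ) :
    PowerSeries ℂ)
  rw [Unit_of_divided_by_X_pow_order_nonzero (h0 _), X_pow_order_mul_divXPowOrder]

theorem exists_mem_orbit_of_units {e : Fin n → Λ} {ν : Module.Dual ℤ M}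
    (hν : ∀ v : Λ, 0 ≤ ν v) (hpos : ∀ i, 0 < ν (e i))
    (u : Multiplicative M →* (PowerSeries ℂ)ˣ) :
    ∃ h ∈ orbit e ν, ∀ v : Λ,
      h (monom v) = X ^ (ν v).toNat * (u (Multiplicative.ofAdd (v : M)) : PowerSeries ℂ) := by
  let F : Multiplicative Λ →* PowerSeries ℂ :=
    { toFun := fun v => X ^ (ν v.toAdd).toNat *
        (u (Multiplicative.ofAdd (v.toAdd : M)) : PowerSeries ℂ)
      map_one' := by simp
      map_mul' := fun v v' => by
        have h1 : (ν ((v * v').toAdd : Λ)).toNat = (ν v.toAdd).toNat + (ν v'.toAdd).toNat := by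
          rw [toAdd_mul, AddSubmonoid.coe_add, map_add, Int.toNat_add (hν _) (hν _)]
        rw [h1, toAdd_mul, AddSubmonoid.coe_add, ofAdd_add, map_mul, Units.val_mul, pow_add]
        ring }
  have hF : ∀ v : Λ, AddMonoidAlgebra.lift ℂ _ _ F (monom v) =
      X ^ (ν v).toNat * (u (Multiplicative.ofAdd (v : M)) : PowerSeries ℂ) := fun v => by
    rw [monom, AddMonoidAlgebra.lift_single, one_smul]
    rfl
  refine ⟨AddMonoidAlgebra.lift ℂ _ _ F, ⟨⟨fun i => ?_, fun v => ?_⟩, fun v => ?_⟩, hF⟩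
  · rw [hF, map_mul, map_pow, constantCoeff_X, zero_pow, zero_mul]
    have := hpos i
    omega
  · rw [hF]
    exact mul_ne_zero (pow_ne_zero _ X_ne_zero) (Units.ne_zero _)
  · rw [hF, order_mul, order_X_pow, order_zero_of_unit, add_zero, ENat.toNat_natCast,
      Int.toNat_of_nonneg (hν v)]
    exact Units.isUnit _

theorem exists_formalExp_of_mem_orbit (hgen : AddSubgroup.closure (Λ : Set M) = ⊤)
    {e : Fin n → Λ} {ν : Module.Dual ℤ M} {h : Arc Λ} (hh : h ∈ orbit e ν) :
    ∃ (c : Multiplicative M →* ℂˣ) (W : M →+ PowerSeries ℂ), ∀ v : Λ,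
      h (monom v) = X ^ (ν v).toNat *
        (C (c (Multiplicative.ofAdd (v : M)) : ℂ) * formalExp (W v)) := by
  obtain ⟨u, hu⟩ := exists_units_of_mem_orbit hgen hh
  refine ⟨(Units.map (constantCoeff (R := ℂ)).toMonoidHom).comp u,
    AddMonoidHom.mk' (fun m => logSeries (u (Multiplicative.ofAdd m))) fun m m' => ?_,
    fun v => ?_⟩
  · rw [ofAdd_add, map_mul, logSeries_mul]
  · rw [hu]
    congr 1
    exact (C_mul_formalExp_logSeries _).symm

theorem exists_mem_orbit_of_formalExp {e : Fin n → Λ} {ν : Module.Dual ℤ M}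
    (hν : ∀ v : Λ, 0 ≤ ν v) (hpos : ∀ i, 0 < ν (e i))
    (c : Multiplicative M →* ℂˣ) (W : M →+ PowerSeries ℂ) :
    ∃ h ∈ orbit e ν, ∀ v : Λ, h (monom v) = X ^ (ν v).toNat *
        (C (c (Multiplicative.ofAdd (v : M)) : ℂ) * formalExp (W v)) := by
  let u : Multiplicative M →* PowerSeries ℂ :=
    { toFun := fun m => C (c m : ℂ) * formalExp (W m.toAdd)
      map_one' := by simp [formalExp_zero]
      map_mul' := fun m m' => by
        rw [map_mul, Units.val_mul, map_mul, toAdd_mul, map_add, formalExp_add]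
        ring }
  obtain ⟨h, hh, hv⟩ := exists_mem_orbit_of_units hν hpos u.toHomUnits
  exact ⟨h, hh, fun v => hv v⟩

end Arcs

/-! ### Additive maps and real linear relations -/

section Extension

variable {M : Type*} [AddCommGroup M] {ι V : Type*} [AddCommGroup V] [Module ℝ V]

theorem exists_linearMap_toReal (W : M →+ V) :
    ∃ W' : ℝ ⊗[ℤ] M →ₗ[ℝ] V, ∀ m, W' (toReal m) = W m :=
  ⟨LinearMap.liftBaseChange ℝ W.toIntLinearMap, fun m => by simp [toReal]⟩

/-- The homomorphism `m ↦ 1 ⊗ m` from `M` to `M_ℝ`. -/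
def toRealHom (M : Type*) [AddCommGroup M] : M →+ ℝ ⊗[ℤ] M where
  toFun := toReal
  map_zero' := TensorProduct.tmul_zero _ _
  map_add' := TensorProduct.tmul_add _

theorem exists_addMonoidHom_extension {b : ι → M}
    (hb : LinearIndependent ℝ fun j => toReal (b j)) (w : ι → V) :
    ∃ W : M →+ V, ∀ j, W (b j) = w j := by
  obtain ⟨W, hW⟩ := LinearMap.exists_extend ((Module.Basis.span hb).constr ℝ w)
  refine ⟨W.toAddMonoidHom.comp (toRealHom M), fun j => ?_⟩
  have h1 := (Module.Basis.span hb).constr_basis ℝ w j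
  rw [← hW] at h1
  rw [← h1, LinearMap.comp_apply, Module.Basis.span_apply hb]
  rfl

/-- The `b j` may span a non-saturated sublattice; the extension exists all the same because `ℂ^*`
is divisible: choose logarithms, extend them additively, exponentiate. -/
theorem exists_character_extension {b : ι → M}
    (hb : LinearIndependent ℝ fun j => toReal (b j)) (χ : ι → ℂˣ) :
    ∃ c : Multiplicative M →* ℂˣ, ∀ j, c (Multiplicative.ofAdd (b j)) = χ j := by
  obtain ⟨W, hW⟩ := exists_addMonoidHom_extension hb fun j => Complex.log (χ j)
  let u : Multiplicative M →* ℂ :=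
    { toFun := fun m => Complex.exp (W m.toAdd)
      map_one' := by simp
      map_mul' := fun m m' => by rw [toAdd_mul, map_add, Complex.exp_add] }
  refine ⟨u.toHomUnits, fun j => Units.ext ?_⟩
  change Complex.exp (W (b j)) = _
  rw [hW, Complex.exp_log (χ j).ne_zero]

end Extension

/-! ### Immersions of affine schemes and rational points -/

section Immersions

variable {R B : Type} [CommRing R] [CommRing B] [Algebra ℂ R] [Algebra ℂ B]

/-- The hypotheses make `φ` surjective after inverting `g`: the morphism is a closed immersion into
the open set where `g ≠ 0`. -/
theorem isImmersion_specMap (φ : R →ₐ[ℂ] B) {g : R} (hg : IsUnit (φ g))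
    (hsurj : ∀ b, ∃ a m, b * φ g ^ m = φ a) :
    IsImmersion (Spec.map (CommRingCat.ofHom (φ : R →+* B))) := by
  let ρ : Localization.Away g →+* B := IsLocalization.Away.lift g (g := (φ : R →+* B)) hg
  have hρ : ρ.comp (algebraMap R (Localization.Away g)) = (φ : R →+* B) :=
    IsLocalization.Away.lift_comp g hg
  have hs : Function.Surjective ρ := by
    intro b
    obtain ⟨a, m, h⟩ := hsurj b
    refine ⟨IsLocalization.mk' _ a (⟨g ^ m, m, rfl⟩ : Submonoid.powers g), ?_⟩
    have hu : IsUnit (φ g ^ m) := hg.pow m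
    rw [← hu.mul_left_inj, h, ← map_pow]
    have h1 := congrArg ρ (IsLocalization.mk'_spec (Localization.Away g) a
      (⟨g ^ m, m, rfl⟩ : Submonoid.powers g))
    have h2 : ∀ r, ρ (algebraMap R (Localization.Away g) r) = φ r := fun r =>
      DFunLike.congr_fun hρ r
    rwa [map_mul, h2, h2] at h1
  rw [← hρ, CommRingCat.ofHom_comp, Spec.map_comp]
  have : IsClosedImmersion (Spec.map (CommRingCat.ofHom ρ)) :=
    IsClosedImmersion.spec_of_surjective _ hs
  infer_instance

/-- A prime of `B` over a rational point is itself rational: modulo it, each `b = φ a / φ g ^ m`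
becomes the constant `x a / x g ^ m`. -/
theorem closedPoint_mem_range_iff (φ : R →ₐ[ℂ] B) {g : R} (hg : IsUnit (φ g))
    (hsurj : ∀ b, ∃ a m, b * φ g ^ m = φ a) (x : R →ₐ[ℂ] ℂ) :
    closedPoint x ∈ Set.range (Spec.map (CommRingCat.ofHom (φ : R →+* B))) ↔
      ∃ y : B →ₐ[ℂ] ℂ, x = y.comp φ := by
  constructor
  · rintro ⟨p, hp⟩
    have hker : ∀ r, φ r ∈ p.asIdeal ↔ x r = 0 := fun r => by
      have := congrArg (fun q : PrimeSpectrum R => r ∈ q.asIdeal) hp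
      exact iff_of_eq this
    have hmk : ∀ r, Ideal.Quotient.mk p.asIdeal (φ r) =
        algebraMap ℂ (B ⧸ p.asIdeal) (x r) := fun r => by
      have h1 : φ (r - algebraMap ℂ R (x r)) ∈ p.asIdeal :=
        (hker _).2 (by rw [map_sub, AlgHom.commutes, Algebra.algebraMap_self_apply, sub_self])
      rw [map_sub, AlgHom.commutes] at h1
      exact (Ideal.Quotient.eq.2 h1)
    have hg0 : x g ≠ 0 := fun h =>
      p.2.ne_top (Ideal.eq_top_of_isUnit_mem _ ((hker g).2 h) hg)
    have hbij : Function.Bijective (Algebra.ofId ℂ (B ⧸ p.asIdeal)) := by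
      have : p.asIdeal.IsPrime := p.2
      refine ⟨(algebraMap ℂ (B ⧸ p.asIdeal)).injective, fun c => ?_⟩
      obtain ⟨b, rfl⟩ := Ideal.Quotient.mk_surjective c
      obtain ⟨a, m, h⟩ := hsurj b
      refine ⟨x a / x g ^ m, ?_⟩
      have h1 := congrArg (Ideal.Quotient.mk p.asIdeal) h
      rw [map_mul, map_pow, hmk, hmk, ← map_pow] at h1
      have hu : IsUnit (algebraMap ℂ (B ⧸ p.asIdeal) (x g ^ m)) :=
        (IsUnit.mk0 _ (pow_ne_zero m hg0)).map _
      rw [← hu.mul_left_inj, h1, Algebra.ofId_apply, ← map_mul,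
        div_mul_cancel₀ _ (pow_ne_zero m hg0)]
    refine ⟨((AlgEquiv.ofBijective _ hbij).symm : (B ⧸ p.asIdeal) →ₐ[ℂ] ℂ).comp
      (Ideal.Quotient.mkₐ ℂ p.asIdeal), AlgHom.ext fun r => ?_⟩
    change _ = (AlgEquiv.ofBijective _ hbij).symm (Ideal.Quotient.mk p.asIdeal (φ r))
    rw [hmk, AlgEquiv.commutes]
    rfl
  · rintro ⟨y, rfl⟩
    exact ⟨closedPoint y, PrimeSpectrum.ext rfl⟩

theorem reducedIso_range [IsReduced B] (φ : R →ₐ[ℂ] B) {g : R} (hg : IsUnit (φ g))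
    (hsurj : ∀ b, ∃ a m, b * φ g ^ m = φ a) :
    ReducedIso (Set.range (Spec.map (CommRingCat.ofHom (φ : R →+* B)))) B := by
  refine ⟨(affine_isReduced_iff _).2 ‹_›, Spec.map (CommRingCat.ofHom (φ : R →+* B)), ?_,
    isImmersion_specMap φ hg hsurj, rfl⟩
  rw [structureMap, structureMap, ← Spec.map_comp, ← CommRingCat.ofHom_comp, AlgHom.comp_algebraMap]

theorem exists_isLocallyClosed_of_fraction [IsReduced B] (φ : R →ₐ[ℂ] B) {g : R}
    (hg : IsUnit (φ g)) (hsurj : ∀ b, ∃ a m, b * φ g ^ m = φ a) {T : Set (R →ₐ[ℂ] ℂ)}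
    (hT : ∀ x, (∃ y : B →ₐ[ℂ] ℂ, x = y.comp φ) ↔ x ∈ T) :
    ∃ Z : Set (Spec (CommRingCat.of R)), IsLocallyClosed Z ∧
      (∀ x : R →ₐ[ℂ] ℂ, closedPoint x ∈ Z ↔ x ∈ T) ∧ ReducedIso Z B := by
  have := isImmersion_specMap φ hg hsurj
  exact ⟨_, (Spec.map (CommRingCat.ofHom (φ : R →+* B))).isLocallyClosed_range,
    fun x => (closedPoint_mem_range_iff φ hg hsurj x).trans (hT x), reducedIso_range φ hg hsurj⟩

theorem ReducedIso.congr {Z : Set (Spec (CommRingCat.of R))} {C : Type} [CommRing C] [Algebra ℂ C]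
    (h : ReducedIso Z B) (E : B ≃ₐ[ℂ] C) : ReducedIso Z C := by
  obtain ⟨hB, f, hf, hi, hZ⟩ := h
  have hB' := (affine_isReduced_iff _).1 hB
  have hiso : IsIso (Spec.map (E.symm : C ≃+* B).toCommRingCatIso.hom) := inferInstance
  refine ⟨(affine_isReduced_iff _).2 (isReduced_of_injective (E.symm : C ≃+* B)
    E.symm.injective), Spec.map (E : B ≃+* C).toCommRingCatIso.hom ≫ f, ?_, inferInstance, ?_⟩
  · rw [Category.assoc, hf, structureMap, structureMap, ← Spec.map_comp]
    congr 1
    ext c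
    exact E.commutes c
  · rw [← hZ]
    have hs : Function.Surjective (Spec.map (E : B ≃+* C).toCommRingCatIso.hom) :=
      (Spec.map (E : B ≃+* C).toCommRingCatIso.hom).surjective
    change Set.range (fun x => f (Spec.map (E : B ≃+* C).toCommRingCatIso.hom x)) = _
    exact hs.range_comp f

/-- Nullstellensatz: `B` is a Jacobson ring with all residue fields at maximal ideals equal to `ℂ`.
-/
theorem eq_zero_of_forall_algHom_eq_zero [IsReduced B] [Algebra.FiniteType ℂ B] {b : B}
    (h : ∀ y : B →ₐ[ℂ] ℂ, y b = 0) : b = 0 := by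
  have hJ : IsJacobsonRing B := isJacobsonRing_of_finiteType (A := ℂ)
  have h0 : (⊥ : Ideal B).jacobson = ⊥ :=
    hJ.out Ideal.isRadical_bot
  have hb : b ∈ (⊥ : Ideal B).jacobson := by
    rw [Ideal.jacobson, Ideal.mem_sInf]
    rintro P ⟨-, hP⟩
    let _ : Field (B ⧸ P) := Ideal.Quotient.field P
    have : Algebra.FiniteType ℂ (B ⧸ P) := inferInstance
    have hfin : Module.Finite ℂ (B ⧸ P) := finite_of_finite_type_of_isJacobsonRing ℂ (B ⧸ P)
    have hbij : Function.Bijective (Algebra.ofId ℂ (B ⧸ P)) :=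
      IsAlgClosed.algebraMap_bijective_of_isIntegral
    have h1 := h (((AlgEquiv.ofBijective _ hbij).symm : (B ⧸ P) →ₐ[ℂ] ℂ).comp
      (Ideal.Quotient.mkₐ ℂ P))
    change (AlgEquiv.ofBijective _ hbij).symm (Ideal.Quotient.mk P b) = 0 at h1
    rw [map_eq_zero_iff _ (AlgEquiv.injective _)] at h1
    exact Ideal.Quotient.eq_zero_iff_mem.1 h1
  rw [h0] at hb
  exact hb

end Immersions

/-- The coordinate ring of `(ℂ^*)^0 × 𝔸^0`. -/
def torusAffineRingZero : TorusAffineRing 0 0 ≃ₐ[ℂ] ℂ :=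
  ((MvPolynomial.isEmptyAlgEquiv (AddMonoidAlgebra ℂ (Fin 0 → ℤ)) (Fin 0)).restrictScalars ℂ).trans
    (AddMonoidAlgebra.uniqueAlgEquiv ℂ (Fin 0 → ℤ))

/-! ### The coordinates of the jets of an orbit -/

section JetCoordinates

open PowerSeries

variable {M : Type*} [AddCommGroup M] {Λ : AddSubmonoid M} {n : ℕ}

/-- The order of the coordinate `x_i` along the arcs of order `ν`. -/
def weight (e : Fin n → Λ) (ν : Module.Dual ℤ M) (i : Fin n) : ℕ := (ν (e i)).toNat

/-- Among the generators of weight at most `s`, a basis `e (b j)` over `ℝ` of the space they span,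
in which no generator involves basis vectors of greater weight, and a basis `ℓ` of the lattice
they generate. -/
structure JetFrame (e : Fin n → Λ) (ν : Module.Dual ℤ M) (s k : ℕ) where
  b : Fin k → Fin n
  b_indep : LinearIndependent ℝ fun j => toReal (e (b j) : M)
  b_le : ∀ j, weight e ν (b j) ≤ s
  q : Fin n → Fin k → ℝ
  q_eq : ∀ i, weight e ν i ≤ s → toReal (e i : M) = ∑ j, q i j • toReal (e (b j) : M)
  q_le : ∀ i j, weight e ν i ≤ s → q i j ≠ 0 → weight e ν (b j) ≤ weight e ν i
  ℓ : Fin k → M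
  ℓ_indep : LinearIndependent ℝ fun j => toReal (ℓ j)
  z : Fin n → Fin k → ℤ
  z_eq : ∀ i, weight e ν i ≤ s → (e i : M) = ∑ j, z i j • ℓ j
  z_gen : AddSubgroup.closure (z '' {i | weight e ν i ≤ s}) = ⊤

namespace JetFrame

variable {e : Fin n → Λ} {ν : Module.Dual ℤ M} {s k : ℕ} (F : JetFrame e ν s k)

/-- The indices of the coordinates of the affine factor. -/
abbrev Index : Type := Σ j : Fin k, Fin (s - weight e ν (F.b j))

theorem q_b (j j' : Fin k) : F.q (F.b j) j' = if j' = j then 1 else 0 := by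
  have h := F.q_eq (F.b j) (F.b_le j)
  have h1 : ∑ j', (F.q (F.b j) j' - if j' = j then 1 else 0) • toReal (e (F.b j') : M) = 0 := by
    simp only [sub_smul, Finset.sum_sub_distrib, ← h]
    simp
  exact sub_eq_zero.1 (Fintype.linearIndependent_iff.1 F.b_indep _ h1 j')

variable {B C : Type*} [CommRing B] [Algebra ℂ B] [CommRing C] [Algebra ℂ C]

/-- The polynomial `∑ Y_{j,l} t^{l + 1}`. -/
def logPolynomial (Y : F.Index → B) (j : Fin k) : PowerSeries B :=
  PowerSeries.mk fun l =>
    if h : l ≠ 0 ∧ l - 1 < s - weight e ν (F.b j) then Y ⟨j, l - 1, h.2⟩ else 0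

/-- The coefficient of `t^r` in `t^{w_i} c_i exp (∑ q_{ij} Y_j(t))`. -/
def jetCoeff (c : Fin n → B) (Y : F.Index → B) (i : Fin n) (r : ℕ) : B :=
  if weight e ν i ≤ s then
    coeff r (X ^ weight e ν i *
      (PowerSeries.C (c i) * formalExp (∑ j, (F.q i j : ℂ) • F.logPolynomial Y j)))
  else 0

theorem map_logPolynomial (f : B →ₐ[ℂ] C) (Y : F.Index → B) (j : Fin k) :
    PowerSeries.map (f : B →+* C) (F.logPolynomial Y j) = F.logPolynomial (fun a => f (Y a)) j := by
  ext l
  rw [coeff_map, logPolynomial, logPolynomial, coeff_mk, coeff_mk]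
  split_ifs
  · rfl
  · exact map_zero f

theorem map_jetCoeff (f : B →ₐ[ℂ] C) (c : Fin n → B) (Y : F.Index → B) (i : Fin n) (r : ℕ) :
    f (F.jetCoeff c Y i r) = F.jetCoeff (fun i => f (c i)) (fun a => f (Y a)) i r := by
  unfold jetCoeff
  split_ifs
  · rw [coeff_X_pow_mul', coeff_X_pow_mul']
    split_ifs
    · have h : PowerSeries.map (f : B →+* C) (∑ j, (F.q i j : ℂ) • F.logPolynomial Y j) =
          ∑ j, (F.q i j : ℂ) • F.logPolynomial (fun a => f (Y a)) j := by
        rw [map_sum (PowerSeries.map (f : B →+* C))]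
        refine Finset.sum_congr rfl fun j _ => ?_
        rw [← map_logPolynomial]
        ext l
        exact map_smul f (F.q i j : ℂ) (coeff l (F.logPolynomial Y j))
      rw [coeff_C_mul, coeff_C_mul, map_mul, map_formalExp, h]
    · exact map_zero f
  · exact map_zero f

variable {m : ℕ} (idx : F.Index ≃ Fin m)

/-- The monomials of the torus factor. -/
def torusMonomial (k m : ℕ) (z : Fin k → ℤ) : TorusAffineRing k m :=
  MvPolynomial.C (AddMonoidAlgebra.single z 1)

theorem torusMonomial_zero (k m : ℕ) : torusMonomial k m 0 = 1 := by
  rw [torusMonomial, ← AddMonoidAlgebra.one_def, map_one]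

theorem torusMonomial_add (k m : ℕ) (z z' : Fin k → ℤ) :
    torusMonomial k m (z + z') = torusMonomial k m z * torusMonomial k m z' := by
  rw [torusMonomial, torusMonomial, torusMonomial, ← map_mul,
    AddMonoidAlgebra.single_mul_single, one_mul]

/-- The morphism from the torus times the affine space to the space of jets. -/
def jetHom : AffineJetRing n s →ₐ[ℂ] TorusAffineRing k m :=
  MvPolynomial.aeval fun p => F.jetCoeff (fun i => torusMonomial k m (F.z i))
    (fun a => MvPolynomial.X (idx a)) p.1 p.2

theorem jetHom_X (i : Fin n) (r : Fin (s + 1)) :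
    F.jetHom idx (MvPolynomial.X (i, r)) = F.jetCoeff (fun i => torusMonomial k m (F.z i))
      (fun a => MvPolynomial.X (idx a)) i r :=
  MvPolynomial.aeval_X _ _

/-- An additive map to a vector space extends linearly to `M_ℝ`, so it respects real relations
between lattice vectors. -/
theorem smul_apply_e {V : Type*} [AddCommGroup V] [Module ℂ V] (W : M →+ V) {i : Fin n}
    (hi : weight e ν i ≤ s) : W (e i) = ∑ j, (F.q i j : ℂ) • W (e (F.b j)) := by
  let _ : Module ℝ V := Module.compHom V (algebraMap ℝ ℂ)
  obtain ⟨W', hW'⟩ := exists_linearMap_toReal W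
  rw [← hW', F.q_eq i hi, map_sum]
  refine Finset.sum_congr rfl fun j _ => ?_
  rw [map_smul, hW']
  rfl

theorem exists_arc_of_point (hν : ∀ v : Λ, 0 ≤ ν v) (hpos : ∀ i, 0 < ν (e i))
    (y : TorusAffineRing k m →ₐ[ℂ] ℂ) :
    ∃ h ∈ orbit e ν, y.comp (F.jetHom idx) = jetEval e s h := by
  let ψ₀ : Multiplicative (Fin k → ℤ) →* ℂ :=
    { toFun := fun z => y (torusMonomial k m z.toAdd)
      map_one' := by rw [toAdd_one, torusMonomial_zero, map_one]
      map_mul' := fun a b => by rw [toAdd_mul, torusMonomial_add, map_mul] }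
  let ψ := ψ₀.toHomUnits
  -- A point prescribes the character only on the lattice of the `ℓ j`, and `W` only on the `e (b
  -- j)`; any extensions to `M` will do.
  obtain ⟨c, hc⟩ := exists_character_extension F.ℓ_indep
    fun j => ψ (Multiplicative.ofAdd (Pi.single j 1))
  obtain ⟨W, hW⟩ := exists_addMonoidHom_extension F.b_indep
    fun j => F.logPolynomial (fun a => y (MvPolynomial.X (idx a))) j
  obtain ⟨h, hh, hv⟩ := exists_mem_orbit_of_formalExp hν hpos c W
  refine ⟨h, hh, MvPolynomial.algHom_ext fun ⟨i, r⟩ => ?_⟩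
  have h1 : jetEval e s h (MvPolynomial.X (i, r)) = coeff (r : ℕ) (h (monom (e i))) :=
    MvPolynomial.aeval_X _ _
  rw [AlgHom.comp_apply, jetHom_X, map_jetCoeff, h1, hv]
  change _ = coeff (r : ℕ) (X ^ weight e ν i * _)
  rw [jetCoeff]
  split_ifs with hi
  · have h2 : (c (Multiplicative.ofAdd (e i : M)) : ℂ) = y (torusMonomial k m (F.z i)) := by
      have h3 : c (Multiplicative.ofAdd (e i : M)) = ψ (Multiplicative.ofAdd (F.z i)) := by
        have h4 : F.z i = ∑ j, F.z i j • (Pi.single j 1 : Fin k → ℤ) := by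
          ext x
          simp [Finset.sum_apply, Pi.single_apply]
        rw [F.z_eq i hi, h4, ofAdd_sum, ofAdd_sum, map_prod, map_prod, ← h4]
        refine Finset.prod_congr rfl fun j _ => ?_
        rw [ofAdd_zsmul, ofAdd_zsmul, map_zpow, map_zpow, hc]
      rw [h3]
      rfl
    rw [h2, F.smul_apply_e W hi]
    simp only [hW]
  -- A coordinate of weight greater than `s` has zero `s`-jet.
  · rw [coeff_X_pow_mul', if_neg]
    have := r.2
    omega

theorem exists_point_of_arc (hgen : AddSubgroup.closure (Λ : Set M) = ⊤) {h : Arc Λ}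
    (hh : h ∈ orbit e ν) :
    ∃ y : TorusAffineRing k m →ₐ[ℂ] ℂ, y.comp (F.jetHom idx) = jetEval e s h := by
  obtain ⟨c, W, hv⟩ := exists_formalExp_of_mem_orbit hgen hh
  let ψ : Multiplicative (Fin k → ℤ) →* ℂ := (Units.coeHom ℂ).comp
    (c.comp (AddMonoidHom.toMultiplicative (Fintype.linearCombination ℤ F.ℓ).toAddMonoidHom))
  let Y : F.Index → ℂ := fun a => coeff ((a.2 : ℕ) + 1) (W (e (F.b a.1)))
  let y : TorusAffineRing k m →ₐ[ℂ] ℂ :=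
    MvPolynomial.aevalTower (AddMonoidAlgebra.lift ℂ ℂ _ ψ) fun a => Y (idx.symm a)
  have hyX : ∀ a, y (MvPolynomial.X (idx a)) = Y a := fun a => by
    rw [MvPolynomial.aevalTower_X, Equiv.symm_apply_apply]
  have hyz : ∀ i, weight e ν i ≤ s →
      y (torusMonomial k m (F.z i)) = c (Multiplicative.ofAdd (e i : M)) := fun i hi => by
    rw [torusMonomial, MvPolynomial.aevalTower_C, AddMonoidAlgebra.lift_single, one_smul,
      F.z_eq i hi]
    rfl
  refine ⟨y, MvPolynomial.algHom_ext fun ⟨i, r⟩ => ?_⟩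
  have h1 : jetEval e s h (MvPolynomial.X (i, r)) = coeff (r : ℕ) (h (monom (e i))) :=
    MvPolynomial.aeval_X _ _
  rw [AlgHom.comp_apply, jetHom_X, map_jetCoeff, h1, hv]
  change _ = coeff (r : ℕ) (X ^ weight e ν i * _)
  have hr := r.2
  simp only [hyX]
  rw [jetCoeff]
  split_ifs with hi
  · rw [hyz i hi, F.smul_apply_e W hi, coeff_X_pow_mul', coeff_X_pow_mul']
    split_ifs with hir
    · rw [coeff_C_mul, coeff_C_mul]
      congr 1
      refine coeff_formalExp_congr fun l hl hl' => ?_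
      rw [map_sum, map_sum]
      refine Finset.sum_congr rfl fun j _ => ?_
      rw [map_smul, map_smul]
      by_cases hq : F.q i j = 0
      · rw [hq, Complex.ofReal_zero, zero_smul, zero_smul]
      -- As `w_{b j} ≤ w_i`, the degree satisfies `l ≤ r - w_i ≤ s - w_{b j}`, so the truncated
      -- logarithm still contains this coefficient.
      · have := F.q_le i j hi hq
        rw [logPolynomial, coeff_mk, dif_pos (by omega)]
        change _ • coeff (l - 1 + 1) _ = _
        rw [Nat.sub_add_cancel hl]
    · rfl
  · rw [coeff_X_pow_mul', if_neg]
    omega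

/-- Every rational point of the source gives the jet of an arc, where `f` vanishes; the source being
reduced of finite type, this suffices. -/
theorem jetHom_eq_zero (hν : ∀ v : Λ, 0 ≤ ν v) (hpos : ∀ i, 0 < ν (e i))
    {f : AffineJetRing n s} (hf : f ∈ jetIdeal e s) : F.jetHom idx f = 0 := by
  refine eq_zero_of_forall_algHom_eq_zero fun y => ?_
  obtain ⟨h, hh, hy⟩ := F.exists_arc_of_point idx hν hpos y
  rw [← AlgHom.comp_apply, hy, jetEval_eq_zero e s hh.1.1 f hf]

end JetFrame

/-- The elements of `B` which are fractions `φ a / φ g ^ m`. -/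
def fractionSubalgebra {R B : Type*} [CommRing R] [CommRing B] [Algebra ℂ R] [Algebra ℂ B]
    (φ : R →ₐ[ℂ] B) (g : R) : Subalgebra ℂ B where
  carrier := {b | ∃ a m, b * φ g ^ m = φ a}
  mul_mem' := by
    rintro b b' ⟨a, m, h⟩ ⟨a', m', h'⟩
    exact ⟨a * a', m + m', by rw [map_mul, ← h, ← h']; ring⟩
  add_mem' := by
    rintro b b' ⟨a, m, h⟩ ⟨a', m', h'⟩
    refine ⟨a * g ^ m' + a' * g ^ m, m + m', ?_⟩
    rw [map_add, map_mul, map_mul, ← h, ← h', map_pow, map_pow]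
    ring
  algebraMap_mem' := fun c => ⟨algebraMap ℂ R c, 0, by rw [pow_zero, mul_one, AlgHom.commutes]⟩

/-! ### Recovering the torus and affine coordinates from the jet -/

namespace JetFrame

variable {e : Fin n → Λ} {ν : Module.Dual ℤ M} {s k : ℕ} (F : JetFrame e ν s k) {m : ℕ}
  (idx : F.Index ≃ Fin m)

/-- The product of the leading coefficients of the coordinates of weight at most `s`. -/
def leadingProduct (e : Fin n → Λ) (ν : Module.Dual ℤ M) (s : ℕ) : AffineJetRing n s :=
  ∏ i, if h : weight e ν i ≤ s then MvPolynomial.X (i, ⟨weight e ν i, Nat.lt_succ_of_le h⟩) else 1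

theorem jetHom_leading {i : Fin n} (h : weight e ν i ≤ s) :
    F.jetHom idx (MvPolynomial.X (i, ⟨weight e ν i, Nat.lt_succ_of_le h⟩)) =
      torusMonomial k m (F.z i) := by
  rw [jetHom_X, jetCoeff, if_pos h, coeff_X_pow_mul', if_pos le_rfl, Nat.sub_self, coeff_C_mul,
    coeff_zero_formalExp, mul_one]

theorem torusMonomial_neg_mul (z : Fin k → ℤ) :
    torusMonomial k m (-z) * torusMonomial k m z = 1 := by
  rw [← torusMonomial_add, neg_add_cancel, torusMonomial_zero]

theorem isUnit_jetHom_leadingProduct : IsUnit (F.jetHom idx (leadingProduct e ν s)) := by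
  rw [leadingProduct, map_prod, IsUnit.prod_univ_iff]
  intro i
  split_ifs with h
  · rw [F.jetHom_leading idx h]
    exact IsUnit.of_mul_eq_one_right _ (torusMonomial_neg_mul _)
  · rw [map_one]
    exact isUnit_one

/-- The leading coefficients are monomials whose exponents generate `ℤ^k`, so with inverses they
give the torus coordinates. Dividing the jets of the basis coordinates by them leaves exponentials,
whose logarithms give the affine coordinates. -/
theorem fractionSubalgebra_jetHom :
    fractionSubalgebra (F.jetHom idx) (leadingProduct e ν s) = ⊤ := by
  set S := fractionSubalgebra (F.jetHom idx) (leadingProduct e ν s) with hS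
  have hrange : ∀ a, F.jetHom idx a ∈ S := fun a => ⟨a, 0, by rw [pow_zero, mul_one]⟩
  have hz : ∀ z, torusMonomial k m z ∈ S ∧ torusMonomial k m (-z) ∈ S := by
    intro z
    have hmem : z ∈ AddSubgroup.closure (F.z '' {i | weight e ν i ≤ s}) :=
      F.z_gen ▸ AddSubgroup.mem_top z
    induction hmem using AddSubgroup.closure_induction with
    | mem x hx =>
      obtain ⟨i, hi, rfl⟩ := hx
      replace hi : weight e ν i ≤ s := hi
      refine ⟨F.jetHom_leading idx hi ▸ hrange _, ?_⟩
      rw [hS]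
      -- The inverse of one leading coefficient is the product of the others divided by the whole
      -- product.
      refine ⟨∏ i' ∈ Finset.univ.erase i, if h : weight e ν i' ≤ s then
        MvPolynomial.X (i', ⟨weight e ν i', Nat.lt_succ_of_le h⟩) else 1, 1, ?_⟩
      rw [pow_one, leadingProduct, ← Finset.mul_prod_erase _ _ (Finset.mem_univ i), map_mul,
        ← mul_assoc, dif_pos hi, F.jetHom_leading idx hi, torusMonomial_neg_mul, one_mul]
    | zero =>
      rw [neg_zero, torusMonomial_zero]
      exact ⟨S.one_mem, S.one_mem⟩
    | add x y _ _ hx hy =>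
      rw [neg_add, torusMonomial_add, torusMonomial_add]
      exact ⟨S.mul_mem hx.1 hy.1, S.mul_mem hx.2 hy.2⟩
    | neg x _ hx =>
      rw [neg_neg]
      exact ⟨hx.2, hx.1⟩
  have hC : ∀ p : AddMonoidAlgebra ℂ (Fin k → ℤ), (MvPolynomial.C p : TorusAffineRing k m) ∈ S := by
    intro p
    induction p using AddMonoidAlgebra.induction_on with
    | of z => exact (hz z).1
    | add f g hf hg => rw [map_add]; exact S.add_mem hf hg
    | smul r f hf =>
      have h1 : (MvPolynomial.C (r • f) : TorusAffineRing k m) = r • MvPolynomial.C f := by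
        rw [Algebra.smul_def, Algebra.smul_def, map_mul]
        rfl
      rw [h1]
      exact S.smul_mem hf r
  have hexp : ∀ j, ∀ r ≤ s - weight e ν (F.b j), coeff r (formalExp
      (F.logPolynomial (fun a => (MvPolynomial.X (idx a) : TorusAffineRing k m)) j)) ∈ S := by
    intro j r hr
    have hj := F.b_le j
    have h1 := hrange (MvPolynomial.X (F.b j, ⟨weight e ν (F.b j) + r, by omega⟩))
    rw [jetHom_X, jetCoeff, if_pos hj, coeff_X_pow_mul', if_pos (Nat.le_add_right _ _),
      Nat.add_sub_cancel_left, coeff_C_mul] at h1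
    have h2 := S.mul_mem (hz (F.z (F.b j))).2 h1
    rw [← mul_assoc, torusMonomial_neg_mul, one_mul] at h2
    rwa [Finset.sum_eq_single j (fun j' _ hj' => by
        rw [q_b, if_neg hj', Complex.ofReal_zero, zero_smul])
      (fun hj' => absurd (Finset.mem_univ j) hj'), q_b, if_pos rfl, Complex.ofReal_one,
      one_smul] at h2
  have hX : ∀ a, (MvPolynomial.X a : TorusAffineRing k m) ∈ S := by
    intro a
    obtain ⟨⟨j, l⟩, rfl⟩ := idx.surjective a
    have h1 := coeff_mem_of_coeff_formalExp_mem S (hexp j) l (by omega)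
    rw [logPolynomial, coeff_mk, dif_pos ⟨by omega, by simp⟩] at h1
    exact h1
  rw [eq_top_iff]
  rintro p -
  induction p using MvPolynomial.induction_on with
  | C a => exact hC a
  | add p q hp hq => exact S.add_mem hp hq
  | mul_X p i hp => exact S.mul_mem hp (hX i)

theorem exists_isLocallyClosed_reducedIso (F : JetFrame e ν s k) {m : ℕ}
    (idx : F.Index ≃ Fin m) (hgen : AddSubgroup.closure (Λ : Set M) = ⊤)
    (hν : ∀ v : Λ, 0 ≤ ν v) (hpos : ∀ i, 0 < ν (e i)) :
    ∃ Z : Set (Spec (CommRingCat.of (JetRing e s))), IsLocallyClosed Z ∧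
      (∀ x : JetRing e s →ₐ[ℂ] ℂ, closedPoint x ∈ Z ↔ x ∈ jetsOfOrbit e s ν) ∧
      ReducedIso Z (TorusAffineRing k m) := by
  refine exists_isLocallyClosed_of_fraction (g := Ideal.Quotient.mk _ (leadingProduct e ν s))
    (Ideal.Quotient.liftₐ (jetIdeal e s) (F.jetHom idx) fun f hf => F.jetHom_eq_zero idx hν hpos hf)
    (F.isUnit_jetHom_leadingProduct idx) (fun b => ?_) (fun x => ⟨?_, ?_⟩)
  · have hb : b ∈ fractionSubalgebra (F.jetHom idx) (leadingProduct e ν s) := by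
      rw [fractionSubalgebra_jetHom]
      exact Algebra.mem_top
    obtain ⟨a, m, h⟩ := hb
    exact ⟨Ideal.Quotient.mk _ a, m, h⟩
  · rintro ⟨y, rfl⟩
    obtain ⟨h, hh, hy⟩ := F.exists_arc_of_point idx hν hpos y
    refine ⟨h, hh, AlgHom.ext fun f => ?_⟩
    obtain ⟨f, rfl⟩ := Ideal.Quotient.mk_surjective f
    exact DFunLike.congr_fun hy f
  · rintro ⟨h, hh, rfl⟩
    obtain ⟨y, hy⟩ := F.exists_point_of_arc idx hgen hh
    refine ⟨y, AlgHom.ext fun f => ?_⟩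
    obtain ⟨f, rfl⟩ := Ideal.Quotient.mk_surjective f
    exact (DFunLike.congr_fun hy f).symm

end JetFrame

end JetCoordinates

/-! ### Orders and weights of independent sets of generators -/

section Weights

variable {M : Type*} [AddCommGroup M] {Λ : AddSubmonoid M} {n : ℕ}

theorem dualToReal_toReal (ν : Module.Dual ℤ M) (m : M) : dualToReal ν (toReal m) = (ν m : ℝ) := by
  simp [dualToReal, toReal]

theorem nonneg_of_mem_interiorPoints {ν : Module.Dual ℤ M} (hν : ν ∈ interiorPoints Λ) (v : Λ) :
    0 ≤ ν v := by
  have h := (@interior_subset _ (moduleTopology ℝ (Module.Dual ℝ (ℝ ⊗[ℤ] M))) _ _ hν)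
    (toReal (v : M)) (PointedCone.subset_hull ⟨v, v.2, rfl⟩)
  rw [dualToReal_toReal] at h
  exact_mod_cast h

/-- If `ν v = 0`, then moving `ν` slightly inside `σ` in both directions along a coordinate form
forces that coordinate of `v` to vanish. -/
theorem pos_of_mem_interiorPoints [Module.Free ℤ M] {ν : Module.Dual ℤ M}
    (hν : ν ∈ interiorPoints Λ) {v : Λ} (hv : (v : M) ≠ 0) : 0 < ν v := by
  refine lt_of_le_of_ne (nonneg_of_mem_interiorPoints hν v) fun h0 => hv ?_
  let B := Module.Free.chooseBasis ℤ M
  refine B.forall_coord_eq_zero_iff.1 fun i => ?_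
  let _ : TopologicalSpace (Module.Dual ℝ (ℝ ⊗[ℤ] M)) := moduleTopology ℝ _
  have : IsModuleTopology ℝ (Module.Dual ℝ (ℝ ⊗[ℤ] M)) := ⟨rfl⟩
  have := IsModuleTopology.topologicalAddGroup ℝ (Module.Dual ℝ (ℝ ⊗[ℤ] M))
  have := IsModuleTopology.toContinuousSMul ℝ (Module.Dual ℝ (ℝ ⊗[ℤ] M))
  have hcont : Continuous fun ε : ℝ => dualToReal ν + ε • dualToReal (B.coord i) := by fun_prop
  have hmem : sigma Λ ∈ nhds (dualToReal ν + (0 : ℝ) • dualToReal (B.coord i)) := by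
    rw [zero_smul, add_zero]
    exact mem_interior_iff_mem_nhds.1 hν
  obtain ⟨δ, hδ, hball⟩ := Metric.eventually_nhds_iff.1 (hcont.continuousAt.eventually_mem hmem)
  have key : ∀ ε : ℝ, |ε| < δ → 0 ≤ ε * (B.coord i v : ℝ) := fun ε hε => by
    have h := hball (y := ε) (by rwa [Real.dist_eq, sub_zero]) (toReal (v : M))
      (PointedCone.subset_hull ⟨v, v.2, rfl⟩)
    rwa [LinearMap.add_apply, LinearMap.smul_apply, dualToReal_toReal, dualToReal_toReal, ← h0,
      Int.cast_zero, zero_add, smul_eq_mul] at h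
  have h1 := key (δ / 2) (by rw [abs_of_pos (by positivity)]; linarith)
  have h2 := key (-(δ / 2)) (by rw [abs_neg, abs_of_pos (by positivity)]; linarith)
  have h3 : (δ / 2) * (B.coord i v : ℝ) = 0 := by linarith
  have h4 : (B.coord i v : ℝ) = 0 := (mul_eq_zero.1 h3).resolve_left (by positivity)
  exact_mod_cast h4

theorem ne_zero_of_minimal {e : Fin n → Λ}
    (hmin : Minimal (fun S : Set Λ => AddSubmonoid.closure S = ⊤) (Set.range e)) (i : Fin n) :
    (e i : M) ≠ 0 := by
  intro h0
  have h1 : e i = 0 := Subtype.ext h0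
  have h2 : AddSubmonoid.closure (Set.range e \ {0}) = ⊤ := by
    rw [eq_top_iff, ← hmin.1, AddSubmonoid.closure_le]
    intro x hx
    by_cases hx0 : x = 0
    · rw [hx0]
      exact zero_mem _
    · exact AddSubmonoid.subset_closure ⟨hx, hx0⟩
  exact (hmin.2 h2 Set.sdiff_subset ⟨i, rfl⟩).2 h1

/-- As `ν` is nonnegative on `σ^∨`, neither adding the cone nor taking the convex hull lowers the
minimum over `I`. -/
theorem ord_eq_of_isLeast {ν : Module.Dual ℤ M} (hν : ∀ v : Λ, 0 ≤ ν v) {I : Set M} {u : M}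
    (hu : u ∈ I) (hmin : ∀ v ∈ I, ν u ≤ ν v) : ord Λ I ν = ν u := by
  have hcone : ∀ p ∈ sigmaDual Λ, 0 ≤ dualToReal ν p := by
    intro p hp
    induction hp using Submodule.span_induction with
    | mem x hx =>
      obtain ⟨v, hv, rfl⟩ := hx
      rw [dualToReal_toReal]
      exact_mod_cast hν ⟨v, hv⟩
    | zero => rw [map_zero]
    | add x y _ _ hx hy => rw [map_add]; exact add_nonneg hx hy
    | smul a x _ hx =>
      change 0 ≤ dualToReal ν ((a : ℝ) • x)
      rw [map_smul]
      exact mul_nonneg a.2 hx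
  refine IsLeast.csInf_eq ⟨⟨toReal u, subset_convexHull _ _ ⟨toReal u, ⟨u, hu, rfl⟩, 0,
    Submodule.zero_mem _, add_zero _⟩, dualToReal_toReal ν u⟩, ?_⟩
  rintro _ ⟨x, hx, rfl⟩
  have hsub : newtonPolyhedron Λ I ⊆ {x | (ν u : ℝ) ≤ dualToReal ν x} := by
    refine convexHull_min ?_ (convex_halfSpace_ge (dualToReal ν).isLinear _)
    rintro _ ⟨_, ⟨v, hv, rfl⟩, p, hp, rfl⟩
    have h1 : (ν u : ℝ) ≤ ν v := by exact_mod_cast hmin v hv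
    have h2 := hcone p hp
    simp only [Set.mem_ofPred_eq, map_add, dualToReal_toReal]
    linarith
  exact hsub hx

theorem ιMulti_ne_zero_iff {V : Type*} [AddCommGroup V] [Module ℝ V] {k : ℕ} {v : Fin k → V} :
    ExteriorAlgebra.ιMulti ℝ k v ≠ 0 ↔ LinearIndependent ℝ v := by
  constructor
  · intro h
    by_contra hv
    exact h (AlternatingMap.map_linearDependent _ v hv)
  · intro hv h
    have h1 := (exteriorPower.ιMulti_family_linearIndependent_field k hv).ne_zero
      (Set.powersetCard.ofFinEmbEquiv (RelEmbedding.refl _))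
    rw [exteriorPower.ιMulti_family, Equiv.symm_apply_apply] at h1
    exact h1 (Subtype.ext h)

/-- The linear independence over `ℝ` of a set of generators. -/
def IndepSet (e : Fin n → Λ) (T : Finset (Fin n)) : Prop :=
  LinearIndepOn ℝ (fun i => toReal (e i : M)) (T : Set (Fin n))

/-- The sum of the weights of a set of generators. -/
def totalWeight (e : Fin n → Λ) (ν : Module.Dual ℤ M) (T : Finset (Fin n)) : ℕ :=
  ∑ i ∈ T, weight e ν i

theorem sum_orderEmbOfFin {V : Type*} [AddCommMonoid V] {k : ℕ} {T : Finset (Fin n)}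
    (hT : T.card = k) (f : Fin n → V) : ∑ j, f (T.orderEmbOfFin hT j) = ∑ i ∈ T, f i := by
  conv_rhs => rw [← Finset.map_orderEmbOfFin_univ T hT, Finset.sum_map]
  rfl

theorem mem_logJacobian_iff {e : Fin n → Λ} {k : ℕ} {w : M} :
    w ∈ logJacobian e k ↔
      ∃ T : Finset (Fin n), T.card = k ∧ IndepSet e T ∧ w = ∑ i ∈ T, (e i : M) := by
  constructor
  · rintro ⟨i, hi, rfl⟩
    rw [ιMulti_ne_zero_iff] at hi
    refine ⟨Finset.univ.map i.toEmbedding, by simp, ?_, by simp⟩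
    rw [IndepSet, Finset.coe_map, Finset.coe_univ, Set.image_univ]
    exact (linearIndepOn_range_iff i.injective _).2 hi
  · rintro ⟨T, hT, hind, rfl⟩
    refine ⟨T.orderEmbOfFin hT, ιMulti_ne_zero_iff.2 ?_, ?_⟩
    · rw [IndepSet, ← Finset.range_orderEmbOfFin T hT] at hind
      exact (linearIndepOn_range_iff (T.orderEmbOfFin hT).injective _).1 hind
    · exact (sum_orderEmbOfFin hT fun i => (e i : M)).symm

/-- An independent set of `k` generators of least total weight. -/
def IsMinIndep (e : Fin n → Λ) (ν : Module.Dual ℤ M) (k : ℕ) (T : Finset (Fin n)) : Prop :=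
  (T.card = k ∧ IndepSet e T) ∧
    ∀ T' : Finset (Fin n), T'.card = k → IndepSet e T' → totalWeight e ν T ≤ totalWeight e ν T'

theorem cast_totalWeight {e : Fin n → Λ} {ν : Module.Dual ℤ M} (hν : ∀ v : Λ, 0 ≤ ν v)
    (T : Finset (Fin n)) : (totalWeight e ν T : ℤ) = ν (∑ i ∈ T, (e i : M)) := by
  rw [totalWeight, Nat.cast_sum, map_sum]
  exact Finset.sum_congr rfl fun i _ => Int.toNat_of_nonneg (hν _)

theorem IsMinIndep.ord_eq {e : Fin n → Λ} {ν : Module.Dual ℤ M} (hν : ∀ v : Λ, 0 ≤ ν v) {k : ℕ}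
    {T : Finset (Fin n)} (hT : IsMinIndep e ν k T) :
    ord Λ (logJacobian e k) ν = totalWeight e ν T := by
  rw [ord_eq_of_isLeast hν (mem_logJacobian_iff.2 ⟨T, hT.1.1, hT.1.2, rfl⟩), ← cast_totalWeight hν,
    Int.cast_natCast]
  intro v hv
  obtain ⟨T', h1, h2, rfl⟩ := mem_logJacobian_iff.1 hv
  rw [← cast_totalWeight hν, ← cast_totalWeight hν]
  exact_mod_cast hT.2 T' h1 h2

theorem exists_isMinIndep {e : Fin n → Λ} (ν : Module.Dual ℤ M) {k : ℕ} {T : Finset (Fin n)}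
    (hk : k ≤ T.card) (hT : IndepSet e T) : ∃ T', IsMinIndep e ν k T' := by
  obtain ⟨T', hT', hc⟩ := Finset.exists_subset_card_eq hk
  have hne : {T : Finset (Fin n) | T.card = k ∧ IndepSet e T}.Nonempty :=
    ⟨T', hc, hT.mono (Finset.coe_subset.2 hT')⟩
  obtain ⟨T₀, h0, h1⟩ := Set.exists_min_image _ (totalWeight e ν) (Set.toFinite _) hne
  exact ⟨T₀, h0, fun T' h h' => h1 T' ⟨h, h'⟩⟩

theorem toReal_linearIndependent {ι : Type*} {v : ι → M} (hv : LinearIndependent ℤ v) :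
    LinearIndependent ℝ fun i => toReal (v i) :=
  Module.Flat.linearIndependent_one_tmul hv

variable [Module.Free ℤ M]

theorem IndepSet.card_le [Module.Finite ℤ M] {e : Fin n → Λ} {T : Finset (Fin n)}
    (hT : IndepSet e T) :
    T.card ≤ Module.finrank ℤ M := by
  have h := LinearIndependent.fintype_card_le_finrank hT
  rw [Module.finrank_baseChange] at h
  simpa using h

/-- The generators span `M_ℝ`, so a maximal independent subset is a basis. Hence the infima defining
the orders for `k ≤ d` are over nonempty sets. -/
theorem exists_indepSet {e : Fin n → Λ} (hgen : AddSubgroup.closure (Λ : Set M) = ⊤)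
    (he : AddSubmonoid.closure (Set.range e) = ⊤) :
    ∃ T, IndepSet e T ∧ T.card = Module.finrank ℤ M := by
  classical
  obtain ⟨b, -, -, hspan, hb⟩ := exists_linearIndepOn_extension (K := ℝ)
    (v := fun i => toReal (e i : M)) (linearIndepOn_empty ℝ _) (Set.empty_subset Set.univ)
  refine ⟨b.toFinset, by rwa [IndepSet, Set.coe_toFinset], ?_⟩
  have h1 : ∀ v : Λ, toReal (v : M) ∈ Submodule.span ℝ ((fun i => toReal (e i : M)) '' b) := by
    intro v
    have hv : v ∈ AddSubmonoid.closure (Set.range e) := he ▸ AddSubmonoid.mem_top v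
    induction hv using AddSubmonoid.closure_induction with
    | mem x hx =>
      obtain ⟨i, rfl⟩ := hx
      exact hspan ⟨i, trivial, rfl⟩
    | zero =>
      rw [AddSubmonoid.coe_zero, show toReal (0 : M) = 0 from (toRealHom M).map_zero]
      exact Submodule.zero_mem _
    | add x y _ _ hx hy =>
      rw [AddSubmonoid.coe_add, show toReal (x + y : M) = _ from (toRealHom M).map_add x y]
      exact Submodule.add_mem _ hx hy
  have h2 : Submodule.span ℝ ((fun i => toReal (e i : M)) '' b) = ⊤ := by
    rw [eq_top_iff]
    rintro x -
    induction x using TensorProduct.induction_on with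
    | zero => exact Submodule.zero_mem _
    | tmul r m =>
      obtain ⟨x, y, rfl⟩ := exists_eq_sub_of_closure_eq_top hgen m
      have h3 := Submodule.smul_mem _ r (Submodule.sub_mem _ (h1 x) (h1 y))
      rw [toReal, toReal, ← TensorProduct.tmul_sub, TensorProduct.smul_tmul', smul_eq_mul,
        mul_one] at h3
      exact h3
    | add x y hx hy => exact Submodule.add_mem _ hx hy
  have h4 := finrank_span_eq_card (R := ℝ) hb
  have h5 : Set.range (fun x : b => toReal (e x : M)) = (fun i => toReal (e i : M)) '' b :=
    (Set.image_eq_range (fun i => toReal (e i : M)) b).symm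
  rw [h5, h2, finrank_top, Module.finrank_baseChange] at h4
  rw [h4, Set.toFinset_card]

end Weights

/-! ### The frame of the generators of weight at most `s` -/

section Frames

variable {M : Type*} [AddCommGroup M]

/-- The relevant lattice is spanned by all `v i`, `i ∈ I`, and may be strictly larger than that of
the `v (b j)`; both have the same real span, hence the same rank `k`. -/
theorem exists_lattice_basis [Module.Free ℤ M] [Module.Finite ℤ M] {ι : Type*} {v : ι → M}
    {I : Set ι} {k : ℕ} {b : Fin k → ι} (hbI : ∀ j, b j ∈ I)
    (hb : LinearIndependent ℝ fun j => toReal (v (b j)))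
    (hspan : ∀ i ∈ I, toReal (v i) ∈ Submodule.span ℝ (Set.range fun j => toReal (v (b j)))) :
    ∃ (ℓ : Fin k → M) (z : ι → Fin k → ℤ), LinearIndependent ℝ (fun j => toReal (ℓ j)) ∧
      (∀ i ∈ I, v i = ∑ j, z i j • ℓ j) ∧ AddSubgroup.closure (z '' I) = ⊤ := by
  classical
  let L : Submodule ℤ M := Submodule.span ℤ (v '' I)
  have hvL : ∀ i ∈ I, v i ∈ L := fun i hi => Submodule.subset_span ⟨i, hi, rfl⟩
  have hli : ∀ {r : ℕ} (β : Module.Basis (Fin r) ℤ L),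
      LinearIndependent ℝ fun j => toReal (β j : M) := fun β =>
    toReal_linearIndependent (β.linearIndependent.map' L.subtype L.ker_subtype)
  have hsum : ∀ {r : ℕ} (β : Module.Basis (Fin r) ℤ L) (i : ι) (hi : i ∈ I),
      v i = ∑ j, β.equivFun ⟨v i, hvL i hi⟩ j • (β j : M) := fun β i hi => by
    have h := congrArg L.subtype (β.sum_equivFun ⟨v i, hvL i hi⟩)
    rw [map_sum] at h
    exact h.symm
  have hrank : Module.finrank ℤ L = k := by
    let β := Module.finBasis ℤ L
    have h1 : Submodule.span ℝ (Set.range fun j => toReal (β j : M)) =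
        Submodule.span ℝ (Set.range fun j => toReal (v (b j))) := by
      refine le_antisymm (Submodule.span_le.2 ?_) (Submodule.span_le.2 ?_)
      · rintro _ ⟨j, rfl⟩
        have hL : ∀ x ∈ L, toReal x ∈
            Submodule.span ℝ (Set.range fun j => toReal (v (b j))) := by
          intro x hx
          induction hx using Submodule.span_induction with
          | mem x hx =>
            obtain ⟨i, hi, rfl⟩ := hx
            exact hspan i hi
          | zero =>
            rw [show toReal (0 : M) = 0 from (toRealHom M).map_zero]
            exact Submodule.zero_mem _
          | add x y _ _ hx hy =>
            rw [show toReal (x + y : M) = _ from (toRealHom M).map_add x y]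
            exact Submodule.add_mem _ hx hy
          | smul a x _ hx =>
            rw [show toReal (a • x : M) = _ from map_zsmul (toRealHom M) a x]
            exact zsmul_mem hx a
        exact hL _ (β j).2
      · rintro _ ⟨j, rfl⟩
        have h2 := congrArg (toRealHom M) (hsum β (b j) (hbI j))
        rw [map_sum] at h2
        change toRealHom M (v (b j)) ∈ _
        rw [h2]
        refine Submodule.sum_mem _ fun i _ => ?_
        rw [map_zsmul]
        exact zsmul_mem (Submodule.subset_span (Set.mem_range_self i)) _
    have h3 := finrank_span_eq_card (R := ℝ) (hli β)
    rw [h1, finrank_span_eq_card (R := ℝ) hb] at h3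
    simpa using h3.symm
  let β : Module.Basis (Fin k) ℤ L := Module.finBasisOfFinrankEq ℤ L hrank
  let z : ι → Fin k → ℤ := fun i => if hi : i ∈ I then β.equivFun ⟨v i, hvL i hi⟩ else 0
  have hz : ∀ i (hi : i ∈ I), z i = β.equivFun ⟨v i, hvL i hi⟩ := fun i hi => dif_pos hi
  refine ⟨fun j => β j, z, hli β, fun i hi => ?_, ?_⟩
  · rw [hz i hi]
    exact hsum β i hi
  · rw [eq_top_iff]
    rintro x -
    have key : ∀ y (hy : y ∈ L), β.equivFun ⟨y, hy⟩ ∈ AddSubgroup.closure (z '' I) := by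
      intro y hy
      induction hy using Submodule.span_induction with
      | mem y hy =>
        obtain ⟨i, hi, rfl⟩ := hy
        exact AddSubgroup.subset_closure ⟨i, hi, hz i hi⟩
      | zero =>
        rw [show (⟨0, _⟩ : L) = 0 from rfl, map_zero]
        exact zero_mem _
      | add x y hx hy hx' hy' =>
        rw [show (⟨x + y, _⟩ : L) = ⟨x, hx⟩ + ⟨y, hy⟩ from rfl, map_add]
        exact add_mem hx' hy'
      | smul a x hx hx' =>
        rw [show (⟨a • x, _⟩ : L) = a • ⟨x, hx⟩ from rfl, map_smul]
        exact zsmul_mem hx' a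
    have h := key _ (β.equivFun.symm x).2
    rwa [show (⟨(β.equivFun.symm x : M), _⟩ : L) = β.equivFun.symm x from rfl,
      LinearEquiv.apply_symm_apply] at h

variable {Λ : AddSubmonoid M} {n : ℕ} {e : Fin n → Λ} {ν : Module.Dual ℤ M} {s k : ℕ}
  {T : Finset (Fin n)}

/-- The separate definition of `φ_1` fits the general formula, the empty set having weight zero. -/
theorem phi_succ (hν : ∀ v : Λ, 0 ≤ ν v) {T' : Finset (Fin n)} (hk : k + 1 ≤ Module.finrank ℤ M)
    (hT : IsMinIndep e ν k T) (hT' : IsMinIndep e ν (k + 1) T') :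
    phi e (k + 1) ν = (((totalWeight e ν T' : ℝ) - totalWeight e ν T : ℝ) : EReal) := by
  rw [phi, if_neg (Nat.succ_ne_zero k), if_neg (not_lt.2 hk)]
  by_cases hk0 : k = 0
  · subst hk0
    have h0 : T = ∅ := Finset.card_eq_zero.1 hT.1.1
    rw [if_pos rfl, hT'.ord_eq hν, h0, totalWeight, totalWeight, Finset.sum_empty, Nat.cast_zero,
      sub_zero]
  · rw [if_neg (by omega), Nat.add_sub_cancel, hT'.ord_eq hν, hT.ord_eq hν]

/-- Removing `i` leaves an independent set of `k - 1` elements, of weight at least the minimum;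
hence `w_i ≤ φ_k(ν) ≤ s`. -/
theorem IsMinIndep.weight_le (hT : IsMinIndep e ν k T) (hν : ∀ v : Λ, 0 ≤ ν v)
    (hk : k ≤ Module.finrank ℤ M) (hs : phi e k ν ≤ ((s : ℝ) : EReal)) {i : Fin n} (hi : i ∈ T) :
    weight e ν i ≤ s := by
  cases k with
  | zero =>
    rw [Finset.card_eq_zero.1 hT.1.1] at hi
    exact absurd hi (Finset.notMem_empty i)
  | succ k =>
    have hc : (T.erase i).card = k := by rw [Finset.card_erase_of_mem hi, hT.1.1]; rfl
    have hind : IndepSet e (T.erase i) :=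
      hT.1.2.mono (Finset.coe_subset.2 (Finset.erase_subset i T))
    obtain ⟨T₀, hT₀⟩ := exists_isMinIndep ν hc.ge hind
    rw [phi_succ hν hk hT₀ hT, EReal.coe_le_coe_iff, sub_le_iff_le_add] at hs
    have h1 := hT₀.2 _ hc hind
    have h2 : totalWeight e ν (T.erase i) + weight e ν i = totalWeight e ν T :=
      Finset.sum_erase_add _ _ hi
    have h3 : totalWeight e ν T ≤ s + totalWeight e ν T₀ := by exact_mod_cast hs
    omega

theorem indepSet_insert_iff {i : Fin n} (hi : i ∉ T) : IndepSet e (insert i T) ↔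
    IndepSet e T ∧ toReal (e i : M) ∉
      Submodule.span ℝ ((fun i => toReal (e i : M)) '' (T : Set (Fin n))) := by
  rw [IndepSet, Finset.coe_insert, linearIndepOn_insert (by exact_mod_cast hi)]
  rfl

/-- Otherwise adding `i` to `T` gives an independent set showing `φ_{k+1}(ν) ≤ w_i ≤ s`. -/
theorem IsMinIndep.toReal_mem_span [Module.Free ℤ M] [Module.Finite ℤ M]
    (hT : IsMinIndep e ν k T) (hν : ∀ v : Λ, 0 ≤ ν v)
    (hs : ((s : ℝ) : EReal) < phi e (k + 1) ν) {i : Fin n} (hi : weight e ν i ≤ s) :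
    toReal (e i : M) ∈ Submodule.span ℝ ((fun i => toReal (e i : M)) '' (T : Set (Fin n))) := by
  by_contra hmem
  have hiT : i ∉ T := fun h => hmem (Submodule.subset_span ⟨i, h, rfl⟩)
  have hind := (indepSet_insert_iff hiT).2 ⟨hT.1.2, hmem⟩
  have hc : (insert i T).card = k + 1 := by rw [Finset.card_insert_of_notMem hiT, hT.1.1]
  obtain ⟨T', hT'⟩ := exists_isMinIndep ν hc.ge hind
  -- The independent set of `k + 1` elements ensures `k + 1 ≤ d`, so that `φ_{k+1}` is not the
  -- conventional `+∞`.
  rw [phi_succ hν (hc ▸ hind.card_le) hT hT', EReal.coe_lt_coe_iff, lt_sub_iff_add_lt] at hs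
  have h1 := hT'.2 _ hc hind
  have h2 : totalWeight e ν (insert i T) = weight e ν i + totalWeight e ν T :=
    Finset.sum_insert hiT
  have h3 : s + totalWeight e ν T < totalWeight e ν T' := by exact_mod_cast hs
  omega

/-- If `q j ≠ 0`, replacing `j` by `i` in `T` keeps independence, so by minimality it cannot lower
the weight. -/
theorem IsMinIndep.weight_le_of_coeff_ne_zero (hT : IsMinIndep e ν k T) {i j : Fin n} (hj : j ∈ T)
    {q : Fin n → ℝ} (hq : toReal (e i : M) = ∑ j ∈ T, q j • toReal (e j : M)) (hqj : q j ≠ 0) :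
    weight e ν j ≤ weight e ν i := by
  by_contra! hlt
  have hind : IndepSet e (T.erase j) :=
    hT.1.2.mono (Finset.coe_subset.2 (Finset.erase_subset j T))
  have hmem : toReal (e i : M) ∉ Submodule.span ℝ
      ((fun i => toReal (e i : M)) '' ((T.erase j : Finset (Fin n)) : Set (Fin n))) := by
    intro h
    rw [← Finset.add_sum_erase T _ hj] at hq
    have h1 : ∑ x ∈ T.erase j, q x • toReal (e x : M) ∈ Submodule.span ℝ
        ((fun i => toReal (e i : M)) '' ((T.erase j : Finset (Fin n)) : Set (Fin n))) :=
      Submodule.sum_mem _ fun x hx =>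
        Submodule.smul_mem _ _ (Submodule.subset_span ⟨x, hx, rfl⟩)
    have h2 := Submodule.sub_mem _ h h1
    rw [hq, add_sub_cancel_right, Submodule.smul_mem_iff _ hqj, Finset.coe_erase] at h2
    exact linearIndepOn_iff_notMem_span.1 hT.1.2 j hj h2
  have hi : i ∉ T.erase j := fun h => hmem (Submodule.subset_span ⟨i, h, rfl⟩)
  have hc : (insert i (T.erase j)).card = k := by
    rw [Finset.card_insert_of_notMem hi, Finset.card_erase_add_one hj, hT.1.1]
  have h1 := hT.2 _ hc ((indepSet_insert_iff hi).2 ⟨hind, hmem⟩)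
  have h2 : totalWeight e ν (insert i (T.erase j)) =
    weight e ν i + totalWeight e ν (T.erase j) := Finset.sum_insert hi
  have h3 : totalWeight e ν (T.erase j) + weight e ν j = totalWeight e ν T :=
      Finset.sum_erase_add _ _ hj
  omega

theorem IsMinIndep.exists_jetFrame [Module.Free ℤ M] [Module.Finite ℤ M]
    (hT : IsMinIndep e ν k T) (hν : ∀ v : Λ, 0 ≤ ν v) (hk : k ≤ Module.finrank ℤ M)
    (hs : phi e k ν ≤ ((s : ℝ) : EReal)) (hs' : ((s : ℝ) : EReal) < phi e (k + 1) ν) :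
    ∃ F : JetFrame e ν s k, ∑ j, weight e ν (F.b j) = totalWeight e ν T := by
  let b := T.orderEmbOfFin hT.1.1
  have hbT : ∀ j, b j ∈ T := Finset.orderEmbOfFin_mem T hT.1.1
  have hrange : Set.range b = T := Finset.range_orderEmbOfFin T hT.1.1
  have hb : LinearIndependent ℝ fun j => toReal (e (b j) : M) := by
    have h := hT.1.2
    rw [IndepSet, ← hrange] at h
    exact (linearIndepOn_range_iff b.injective _).1 h
  have hspan : ∀ i, weight e ν i ≤ s →
      toReal (e i : M) ∈ Submodule.span ℝ (Set.range fun j => toReal (e (b j) : M)) := by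
    intro i hi
    have h := hT.toReal_mem_span hν hs' hi
    rwa [← hrange, ← Set.range_comp] at h
  have hle : ∀ j, weight e ν (b j) ≤ s := fun j => hT.weight_le hν hk hs (hbT j)
  have hq : ∀ i, ∃ q : Fin k → ℝ, weight e ν i ≤ s →
      toReal (e i : M) = ∑ j, q j • toReal (e (b j) : M) := fun i => by
    by_cases hi : weight e ν i ≤ s
    · obtain ⟨q, hq⟩ := (Submodule.mem_span_range_iff_exists_fun ℝ).1 (hspan i hi)
      exact ⟨q, fun _ => hq.symm⟩
    · exact ⟨0, fun h => absurd h hi⟩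
  choose q hq using hq
  obtain ⟨ℓ, z, hℓ, hz, hgen⟩ := exists_lattice_basis (v := fun i => (e i : M))
    (I := {i | weight e ν i ≤ s}) (b := b) hle hb hspan
  refine ⟨⟨b, hb, hle, q, hq, fun i j hi hij => ?_, ℓ, hℓ, z, hz, hgen⟩,
    sum_orderEmbOfFin hT.1.1 (weight e ν)⟩
  let q' : Fin n → ℝ := Function.extend b (q i) 0
  have hq' : ∀ j, q' (b j) = q i j := fun j => b.injective.extend_apply _ _ _
  refine hT.weight_le_of_coeff_ne_zero (hbT j) (q := q') ?_ (by rwa [hq'])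
  rw [hq i hi, ← sum_orderEmbOfFin hT.1.1 fun i => q' i • toReal (e i : M)]
  exact Finset.sum_congr rfl fun j _ => by rw [hq']

end Frames

end ToricJets

end

theorem theorem7p1 {M : Type*} [AddCommGroup M] [Module.Free ℤ M] [Module.Finite ℤ M]
    (Λ : AddSubmonoid M)
    (hgen : AddSubgroup.closure (Λ : Set M) = ⊤)
    (hconv : (sigmaDual Λ : ConvexCone ℝ (ℝ ⊗[ℤ] M)).Salient)
    {n : ℕ} (e : Fin n → Λ) (he : Function.Injective e)
    (hmin : Minimal (fun S : Set Λ => AddSubmonoid.closure S = ⊤) (Set.range e))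
    (k : ℕ) (hk : k ≤ Module.finrank ℤ M)
    (ν : Module.Dual ℤ M) (s : ℕ) (hνs : (ν, s) ∈ setA e k) :
    ∃ Z : Set (Spec (CommRingCat.of (JetRing e s))),
      IsLocallyClosed Z ∧
      (∀ x : JetRing e s →ₐ[ℂ] ℂ, closedPoint x ∈ Z ↔ x ∈ jetsOfOrbit e s ν) ∧
      (k = 0 → ReducedIso Z ℂ) ∧
      (0 < k → ∃ m : ℕ, (m : ℝ) = (k : ℝ) * s - ord Λ (logJacobian e k) ν ∧
        ReducedIso Z (TorusAffineRing k m)) := by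
  obtain ⟨hint, hs, hs'⟩ := hνs
  have hν := nonneg_of_mem_interiorPoints hint
  obtain ⟨T₀, hT₀, hc⟩ := exists_indepSet hgen hmin.1
  obtain ⟨T, hT⟩ := exists_isMinIndep ν (hc.symm ▸ hk) hT₀
  obtain ⟨F, hF⟩ := hT.exists_jetFrame hν hk hs hs'
  obtain ⟨Z, hZ, hpts, hiso⟩ := F.exists_isLocallyClosed_reducedIso
    (Fintype.equivFin F.Index) hgen hν
    (fun i => pos_of_mem_interiorPoints hint (ne_zero_of_minimal hmin i))
  refine ⟨Z, hZ, hpts, ?_, fun _ => ⟨_, ?_, hiso⟩⟩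
  · rintro rfl
    -- For `k = 0` there are no affine coordinates either, and the ring reduces to `ℂ`.
    rw [Fintype.card_eq_zero] at hiso
    exact hiso.congr torusAffineRingZero
  -- Here `m = ∑ (s - w_{b j})`; the natural subtractions are genuine because basis weights are at
  -- most `s`.
  · rw [Fintype.card_sigma, hT.ord_eq hν, ← hF]
    push_cast
    simp only [Fintype.card_fin, Nat.cast_sub (F.b_le _), Finset.sum_sub_distrib, Finset.sum_const,
      Finset.card_univ, nsmul_eq_mul]
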